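/- Let $d>1$ be an odd integer, let $0\le r_0<r_1\le\infty$, and put $A(r_0,r_1)=\{x\in\mathbb R^d : r_0<|x|<r_1\}$. Throughout, $1/0$ is read as $\infty$. Let $0\le\tau<\frac1{2r_0}$ and let $f:A(r_0,r_1)\to\mathbb C$ be polyharmonic of infinite order and type $\tau$; that is, $f$ is $C^\infty$ and for every compact $K\subset A(r_0,r_1)$ and every $\varepsilon>0$ there is a constant $C_{K,\varepsilon}>0$ such that $$\max_{x\in K}|\Delta^pf(x)|\le C_{K,\varepsilon}\,(2p)!\,(\tau+\varepsilon)^{2p}\qquad\text{for all } p\in\mathbb N_0,$$ where $\Delta$ is the Laplace operator. For $k\in\mathbb N_0$ let $Y_{k,1},\dots,Y_{k,a_k}$ be a basis of the ($a_k$-dimensional, complex) space of harmonic homogeneous polynomials of degree $k$ in $d$ variables, orthonormal with respect to $\langle g,h\rangle=\int_{\mathbb S^{d-1}}g(\theta)\overline{h(\theta)}\,d\theta$, where $d\theta$ is the surface measure on the unit sphere. For $l\in\{1,\dots,a_k\}$ let $$f_{k,l}(r)=\int_{\mathbb S^{d-1}}f(r\theta)\overline{Y_{k,l}(\theta)}\,d\theta\quad(r_0<r<r_1),\qquad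 \widetilde f_{k,l}(v)=f_{k,l}(e^v).$$ For $j\in\mathbb N_0$ put $\lambda_{2j}=k+2j$ and $\lambda_{2j+1}=-k-d+2+2j$, and for $n\in\mathbb N_0$ put $$D^{(n)}g=\Bigl(\frac{d}{dv}-\lambda_0\Bigr)\cdots\Bigl(\frac{d}{dv}-\lambda_{n-1}\Bigr)g,\qquad q_n(\lambda)=\prod_{j=0}^n(\lambda-\lambda_j),$$ with $D^{(0)}g=g$. Then for all $k\in\mathbb N_0$, all $l\in\{1,\dots,a_k\}$ and every real $v_0$ with $r_0<e^{v_0}<\min\{r_1,\frac1{2\tau}\}$, the double series $$F_{k,l}(z)=\sum_{n=0}^\infty\sum_{j=0}^nD^{(n)}\widetilde f_{k,l}(v_0)\,\frac{e^{-\lambda_jv_0}}{q_n'(\lambda_j)}\,z^{\lambda_j}$$ converges absolutely and compactly in $\{z\in\mathbb C : 0<|z|<\frac1{2\tau}\}$ (the double series and the double series of the absolute values of its terms converge uniformly on every compact subset), and $$F_{k,l}(r)=f_{k,l}(r)\qquad\text{for all } r\in\Bigl(r_0,\min\bigl\{r_1,\tfrac1{2\tau}\bigr\}\Bigr).$$ 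-/

import Mathlib

open scoped NNReal ENNReal Nat ContDiff Laplacian

noncomputable section

namespace Polyharmonic

/-- The annular region `A(r₀, r₁) = {x ∈ ℝ^d ; r₀ < |x| < r₁}`, with `0 ≤ r₀` and `r₁ ≤ ∞`. -/
def annularRegion (d : ℕ) (r₀ : ℝ≥0) (r₁ : ℝ≥0∞) : Set (EuclideanSpace ℝ (Fin d)) :=
  {x | (r₀ : ℝ≥0∞) < ‖x‖ₑ ∧ ‖x‖ₑ < r₁}

/-- `f` is polyharmonic of infinite order and type `τ` on the open set `G`: it is smooth on `G`
(so that all iterated Laplacians exist there), and for all compact `K ⊆ G` and `ε > 0` there is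
`C > 0` such that `|Δ^p f| ≤ C (2p)! (τ + ε)^{2p}` on `K` for all `p`.
The values of `f` outside `G` are irrelevant, since `G` is open. -/
def IsPolyharmonicInfiniteOrder {d : ℕ} (f : EuclideanSpace ℝ (Fin d) → ℂ) (τ : ℝ≥0)
    (G : Set (EuclideanSpace ℝ (Fin d))) : Prop :=
  ContDiffOn ℝ ∞ f G ∧
    ∀ K ⊆ G, IsCompact K → ∀ ε : ℝ, 0 < ε → ∃ C : ℝ, 0 < C ∧ ∀ p : ℕ, ∀ x ∈ K,
      ‖(Laplacian.laplacian^[p] f) x‖ ≤ C * ((2 * p)! : ℝ) * ((τ : ℝ) + ε) ^ (2 * p)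

/-- The complex linear space of harmonic homogeneous polynomials of degree `k` in `d` variables. -/
def harmonicHomogeneous (d k : ℕ) : Submodule ℂ (MvPolynomial (Fin d) ℂ) :=
  MvPolynomial.homogeneousSubmodule (Fin d) ℂ k ⊓
    LinearMap.ker (∑ i : Fin d,
      (MvPolynomial.pderiv i : Derivation ℂ _ _).toLinearMap ∘ₗ
        (MvPolynomial.pderiv i : Derivation ℂ (MvPolynomial (Fin d) ℂ) _).toLinearMap)

/-- `a_k`, the dimension of the space of harmonic homogeneous polynomials of degree `k`. -/
def harmonicDim (d k : ℕ) : ℕ := Module.finrank ℂ (harmonicHomogeneous d k)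

/-- The value of a polynomial with complex coefficients at a point of `ℝ^d`. -/
def evalReal {d : ℕ} (P : MvPolynomial (Fin d) ℂ) (x : EuclideanSpace ℝ (Fin d)) : ℂ :=
  MvPolynomial.eval (fun i => ((x i : ℝ) : ℂ)) P

/-- The surface measure `dθ` on the unit sphere of `ℝ^d`. -/
def surfaceMeasure (d : ℕ) :
    MeasureTheory.Measure (Metric.sphere (0 : EuclideanSpace ℝ (Fin d)) 1) :=
  (MeasureTheory.volume : MeasureTheory.Measure (EuclideanSpace ℝ (Fin d))).toSphere

/-- `Y_1, …, Y_{a_k}` is a basis of the space of harmonic homogeneous polynomials of degree `k`,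
orthonormal for `⟨f, g⟩ = ∫ f(θ) conj(g(θ)) dθ` on the unit sphere
(linear independence follows from orthonormality). -/
def IsOrthonormalHarmonicBasis (d k : ℕ)
    (Y : Fin (harmonicDim d k) → MvPolynomial (Fin d) ℂ) : Prop :=
  Submodule.span ℂ (Set.range Y) = harmonicHomogeneous d k ∧
    ∀ l m, ∫ θ, evalReal (Y l) θ * (starRingEnd ℂ) (evalReal (Y m) θ) ∂(surfaceMeasure d) =
      if l = m then 1 else 0

/-- The Fourier-Laplace coefficient `r ↦ ∫ f(rθ) conj(Y(θ)) dθ`. -/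
def fourierLaplaceCoeff {d : ℕ} (f : EuclideanSpace ℝ (Fin d) → ℂ)
    (Y : MvPolynomial (Fin d) ℂ) (r : ℝ) : ℂ :=
  ∫ θ : Metric.sphere (0 : EuclideanSpace ℝ (Fin d)) 1,
    f (r • (θ : EuclideanSpace ℝ (Fin d))) * (starRingEnd ℂ) (evalReal Y θ) ∂(surfaceMeasure d)

/-- The exponents `λ_{2j}(k) = k + 2j` and `λ_{2j+1}(k) = -k - d + 2 + 2j`. -/
def exponent (d k n : ℕ) : ℤ :=
  if Even n then (k : ℤ) + 2 * ((n / 2 : ℕ) : ℤ)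
  else -(k : ℤ) - (d : ℤ) + 2 + 2 * ((n / 2 : ℕ) : ℤ)

/-- `D^{(n)} g = (d/dv - λ_0) ⋯ (d/dv - λ_{n-1}) g`; the factors commute on smooth functions, and
`D^{(n+1)} g = (d/dv - λ_n) D^{(n)} g`. -/
def genDeriv (d k : ℕ) : ℕ → (ℝ → ℂ) → ℝ → ℂ
  | 0, g => g
  | n + 1, g => fun v => deriv (genDeriv d k n g) v - (exponent d k n : ℂ) * genDeriv d k n g v

/-- `q_n(λ) = ∏_{j=0}^n (λ - λ_j(k))`. -/
def symbolPoly (d k n : ℕ) : Polynomial ℂ :=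
  ∏ j ∈ Finset.range (n + 1), (Polynomial.X - Polynomial.C (exponent d k j : ℂ))

/-- The term `D^{(n)} f̃(v₀) · e^{-λ_j(k) v₀} / q_n'(λ_j(k)) · z^{λ_j(k)}` of the double series, where
`f̃(v) = g(e^v)`. -/
def seriesTerm (d k : ℕ) (g : ℝ → ℂ) (v₀ : ℝ) (n j : ℕ) (z : ℂ) : ℂ :=
  genDeriv d k n (fun v => g (Real.exp v)) v₀ *
    (Complex.exp (-(exponent d k j : ℂ) * (v₀ : ℂ)) /
      (Polynomial.derivative (symbolPoly d k n)).eval (exponent d k j : ℂ)) *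
    z ^ exponent d k j

/-- The sum `∑_{n=0}^∞ ∑_{j=0}^n` of the double series. -/
def seriesSum (d k : ℕ) (g : ℝ → ℂ) (v₀ : ℝ) (z : ℂ) : ℂ :=
  ∑' n : ℕ, ∑ j ∈ Finset.range (n + 1), seriesTerm d k g v₀ n j z

end Polyharmonic

end

/-! ### The exponents and lower bounds for `q_n'(λ_j)`. -/

namespace Polyharmonic

open Finset

/-! The double series is a Taylor series for the operators `D^{(n)}` in the variable `v = log r`,
and the proof estimates its coefficients, its basis functions and its remainder.

Coefficients. On the Fourier-Laplace coefficient, `r²Δ` acts as `(d/dv - k)(d/dv + k + d - 2)`, and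
multiplication by `e^{2pv}` shifts the exponents by `2p`. Hence `D^{(2p)}` of the coefficient of `f`
is `e^{2pv}` times the coefficient of `Δ^p f` (`genDeriv_fourierLaplaceCoeff`), which the type
condition bounds by a multiple of `(2p)! (σ e^v)^{2p}` for any `σ > τ`. Odd orders are not
controlled directly; an interior estimate for the factorized second order equation recovers them
from the two neighbouring even orders (`exists_norm_le_of_factorized_ode`, `exists_genDeriv_bound`).

Basis functions. As `d` is odd, the two families of exponents have opposite parity, so all `λ_j` are
distinct and `q_n'(λ_j)` is comparable, up to a power of `n`, with a product of factorials. A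
binomial estimate then gives `x^{λ_j} / |q_n'(λ_j)| ≤ poly(n) (1 + x)^n (x^{λ_0} + x^{λ_1}) / n!`
(`zpow_exponent_div_nodeProduct_le`). With `x = |z| / e^{v₀}` the terms of the series are dominated
by `poly(n) (σ (e^{v₀} + |z|))^n`, and the ratio is below `1` for `σ` near `τ`, since both radii are
below `1/(2τ)`.

Remainder. With `Φ_n(v) = ∑_j e^{λ_j v} / q_n'(λ_j)`, the sum of `D^{(n)}g(t) Φ_n(v - t)` over `n ≤
N` telescopes under `d/dt` to `D^{(N+1)}g(t) Φ_N(v - t)` and equals `g(v)` at `t = v`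
(`norm_sub_taylorSum_le`). The same two bounds make the remainder tend to `0`, so the convergent
series has sum `f_{k,l}`. -/

theorem exponent_even (d k a : ℕ) : exponent d k (2 * a) = k + 2 * a := by
  simp [exponent]

theorem exponent_odd (d k a : ℕ) : exponent d k (2 * a + 1) = -k - d + 2 + 2 * a := by
  have h : (2 * a + 1) / 2 = a := by omega
  simp [exponent, h]

/-- Exponents of even and odd index differ in parity: `λ_0 - λ_1 = 2k + d - 2` is odd because `d`
is. Within each family they increase by `2`. -/
theorem exponent_injective {d : ℕ} (hodd : Odd d) (k : ℕ) :
    Function.Injective (exponent d k) := by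
  obtain ⟨c, rfl⟩ := hodd
  intro i j h
  obtain ⟨a, rfl | rfl⟩ := Nat.even_or_odd' i <;> obtain ⟨b, rfl | rfl⟩ := Nat.even_or_odd' j <;>
    simp only [exponent_even, exponent_odd] at h <;> push_cast at h <;> omega

theorem exponent_cast_injective {d : ℕ} (hodd : Odd d) (k : ℕ) :
    Function.Injective (fun j => (exponent d k j : ℂ)) :=
  fun _ _ h => exponent_injective hodd k (Int.cast_injective h)

/-- The absolute value of `q_n'(λ_j)`, as a product of natural numbers. -/
def nodeProduct (d k n j : ℕ) : ℕ :=
  ∏ i ∈ (range (n + 1)).erase j, (exponent d k j - exponent d k i).natAbs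

theorem eval_derivative_symbolPoly (d k : ℕ) {n j : ℕ} (hj : j ≤ n) :
    (Polynomial.derivative (symbolPoly d k n)).eval (exponent d k j : ℂ) =
      ∏ i ∈ (range (n + 1)).erase j, ((exponent d k j : ℂ) - exponent d k i) := by
  have := Lagrange.eval_nodal_derivative_eval_node_eq (s := range (n + 1))
    (v := fun j => (exponent d k j : ℂ)) (mem_range.2 (Nat.lt_succ_of_le hj))
  rw [Lagrange.eval_nodal, Lagrange.nodal_eq] at this
  exact this

theorem norm_eval_derivative_symbolPoly (d k : ℕ) {n j : ℕ} (hj : j ≤ n) :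
    ‖(Polynomial.derivative (symbolPoly d k n)).eval (exponent d k j : ℂ)‖ =
      nodeProduct d k n j := by
  rw [eval_derivative_symbolPoly d k hj, norm_prod, nodeProduct, Nat.cast_prod]
  refine prod_congr rfl fun i _ => ?_
  rw [← Int.cast_sub, Complex.norm_intCast, Nat.cast_natAbs, Int.cast_abs]

theorem nodeProduct_pos {d : ℕ} (hodd : Odd d) (k n j : ℕ) : 0 < nodeProduct d k n j := by
  refine Nat.pos_of_ne_zero (prod_ne_zero_iff.2 fun i hi => ?_)
  rw [Int.natAbs_ne_zero, sub_ne_zero]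
  exact (exponent_injective hodd k).ne (mem_erase.1 hi).1.symm

theorem prod_range_parity {α : Type*} [CommMonoid α] (f : ℕ → α) (n : ℕ) :
    ∏ i ∈ range n, f i =
      (∏ i ∈ range ((n + 1) / 2), f (2 * i)) * ∏ i ∈ range (n / 2), f (2 * i + 1) := by
  induction n with
  | zero => simp
  | succ n ih =>
    rw [prod_range_succ, ih]
    obtain ⟨m, rfl | rfl⟩ := Nat.even_or_odd' n
    · have h1 : (2 * m + 1) / 2 = m := by omega
      have h2 : (2 * m + 1 + 1) / 2 = m + 1 := by omega
      have h3 : 2 * m / 2 = m := by omega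
      rw [h1, h2, h3, prod_range_succ, mul_right_comm]
    · have h1 : (2 * m + 1) / 2 = m := by omega
      have h2 : (2 * m + 1 + 1) / 2 = m + 1 := by omega
      have h3 : (2 * m + 1 + 1 + 1) / 2 = m + 1 := by omega
      rw [h1, h2, h3, prod_range_succ (fun i => f (2 * i + 1)), mul_assoc]

theorem prod_range_split_at {α : Type*} [CommMonoid α] (f : ℕ → α) {a N : ℕ} (ha : a ≤ N) :
    ∏ i ∈ range (N + 1), f i =
      (∏ i ∈ range a, f (a - 1 - i)) * f a * ∏ i ∈ range (N - a), f (a + 1 + i) := by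
  obtain ⟨m, rfl⟩ := Nat.exists_eq_add_of_le ha
  rw [show a + m + 1 = a + 1 + m by ring, prod_range_add, prod_range_succ,
    prod_range_reflect]
  simp

theorem prod_two_mul_succ (m : ℕ) : ∏ i ∈ range m, (2 * (i + 1)) = 2 ^ m * m ! := by
  rw [prod_mul_distrib, prod_const, card_range, prod_range_add_one_eq_factorial]

/-- Lower bound for a product of consecutive odd integers passing through the origin. -/
theorem two_pow_mul_factorial_le (s m : ℕ) :
    2 ^ m * m ! ≤ (2 * m + 2) ^ (s + 1) *
      ∏ i ∈ range m, (2 * (i + 1 : ℤ) - (2 * s + 1)).natAbs := by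
  induction s generalizing m with
  | zero =>
    induction m with
    | zero => simp
    | succ m _ =>
      have h : 2 ^ m * m ! ≤ ∏ i ∈ range (m + 1), (2 * (i + 1 : ℤ) - (2 * (0 : ℕ) + 1)).natAbs := by
        rw [prod_range_succ', ← prod_two_mul_succ]
        refine (prod_le_prod' fun i _ => ?_).trans (Nat.le_mul_of_pos_right _ (by norm_num))
        push_cast; omega
      calc 2 ^ (m + 1) * (m + 1)! = (2 * (m + 1)) * (2 ^ m * m !) := by
            rw [Nat.factorial_succ]; ring
        _ ≤ _ := Nat.mul_le_mul (by rw [zero_add, pow_one]; omega) h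
  | succ s ih =>
    rcases m with _ | m
    · simp only [pow_zero, Nat.factorial_zero, mul_one, range_zero, prod_empty]
      exact Nat.one_le_pow _ _ (by norm_num)
    -- Raising `s` by one shifts the odd integers down by `2`: one new factor, at least `1`, enters
    -- at the left end and the last factor is lost, at the cost of one factor of size at most `2m +
    -- 2`.
    · have h : ∏ i ∈ range m, (2 * (i + 1 : ℤ) - (2 * s + 1)).natAbs ≤
          ∏ i ∈ range (m + 1), (2 * (i + 1 : ℤ) - (2 * (s + 1 : ℕ) + 1)).natAbs := by
        rw [prod_range_succ']
        refine le_trans (prod_le_prod' fun i _ => ?_)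
          (Nat.le_mul_of_pos_right _ (by push_cast; omega))
        push_cast; omega
      calc 2 ^ (m + 1) * (m + 1)! = (2 * m + 2) * (2 ^ m * m !) := by
            rw [Nat.factorial_succ]; ring
        _ ≤ (2 * (m + 1) + 2) * ((2 * (m + 1) + 2) ^ (s + 1) * _) :=
          Nat.mul_le_mul (by omega) ((ih m).trans (Nat.mul_le_mul
            (Nat.pow_le_pow_left (by omega) _) h))
        _ = _ := by ring

theorem nodeProduct_eq_ite (d k : ℕ) {n j : ℕ} (hj : j ≤ n) :
    nodeProduct d k n j =
      ∏ i ∈ range (n + 1), if i = j then 1 else (exponent d k j - exponent d k i).natAbs := by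
  rw [nodeProduct, ← mul_prod_erase _ _ (mem_range.2 (Nat.lt_succ_of_le hj)), if_pos rfl, one_mul]
  exact prod_congr rfl fun i hi => (if_neg (mem_erase.1 hi).1).symm

theorem prod_two_mul_dist {a N : ℕ} (ha : a ≤ N) :
    (∏ b ∈ range (N + 1), if b = a then 1 else (2 * (a : ℤ) - 2 * b).natAbs) =
      (2 ^ a * a !) * (2 ^ (N - a) * (N - a)!) := by
  rw [prod_range_split_at _ ha, if_pos rfl, mul_one, ← prod_two_mul_succ, ← prod_two_mul_succ]
  congr 1 <;> refine prod_congr rfl fun i hi => ?_ <;> rw [mem_range] at hi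
  · rw [if_neg (by omega)]; omega
  · rw [if_neg (by omega)]; omega

/-- Lower bound for the distances of `2a` to the points `2b - (2s+1)`. -/
theorem prod_dist_shift_le (s : ℕ) {a N : ℕ} (ha : a ≤ N + 1) :
    (2 ^ a * a !) * (2 ^ (N - a) * (N - a)!) ≤ (2 * N + 2) ^ (s + 1) *
      ∏ b ∈ range (N + 1), (2 * (a : ℤ) - 2 * b + (2 * s + 1)).natAbs := by
  -- The case `a = N + 1` occurs for even `n`, where there is one more node of even index than of
  -- odd index.
  rcases ha.eq_or_lt with rfl | h
  · rw [Nat.sub_eq_zero_of_le (Nat.le_succ N), ← prod_two_mul_succ, ← prod_range_reflect]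
    simp only [pow_zero, Nat.factorial_zero, mul_one]
    refine le_trans (prod_le_prod' fun i hi => ?_)
      (Nat.le_mul_of_pos_left _ (by positivity))
    rw [mem_range] at hi
    omega
  · have ha' : a ≤ N := Nat.lt_succ_iff.1 h
    rw [prod_range_split_at _ ha']
    have h1 : 2 ^ a * a ! ≤ (∏ i ∈ range a,
        (2 * (a : ℤ) - 2 * (a - 1 - i : ℕ) + (2 * s + 1)).natAbs) *
        (2 * (a : ℤ) - 2 * a + (2 * s + 1)).natAbs := by
      rw [← prod_two_mul_succ]
      refine (prod_le_prod' fun i hi => ?_).trans (Nat.le_mul_of_pos_right _ (by omega))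
      rw [mem_range] at hi; omega
    have h2 : 2 ^ (N - a) * (N - a)! ≤ (2 * N + 2) ^ (s + 1) * ∏ i ∈ range (N - a),
        (2 * (a : ℤ) - 2 * (a + 1 + i : ℕ) + (2 * s + 1)).natAbs := by
      refine (two_pow_mul_factorial_le s (N - a)).trans (Nat.mul_le_mul
        (Nat.pow_le_pow_left (by omega) _) (prod_le_prod' fun i _ => ?_))
      push_cast; omega
    calc _ ≤ _ := Nat.mul_le_mul h1 h2
      _ = _ := by ring

/-- Lower bound for the distances of `2a - (2s+1)` to the points `2b`. -/
theorem prod_dist_shift_le' (s : ℕ) {a N : ℕ} (ha : a ≤ N) :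
    (2 ^ a * a !) * (2 ^ (N - a) * (N - a)!) ≤ (2 * N + 2) ^ (s + 1) *
      ∏ b ∈ range (N + 1), (2 * (a : ℤ) - 2 * b - (2 * s + 1)).natAbs := by
  rw [prod_range_split_at _ ha]
  have h1 : 2 ^ (N - a) * (N - a)! ≤ (2 * (a : ℤ) - 2 * a - (2 * s + 1)).natAbs *
      ∏ i ∈ range (N - a), (2 * (a : ℤ) - 2 * (a + 1 + i : ℕ) - (2 * s + 1)).natAbs := by
    rw [← prod_two_mul_succ]
    refine (prod_le_prod' fun i hi => ?_).trans (Nat.le_mul_of_pos_left _ (by omega))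
    push_cast; omega
  have h2 : 2 ^ a * a ! ≤ (2 * N + 2) ^ (s + 1) * ∏ i ∈ range a,
      (2 * (a : ℤ) - 2 * (a - 1 - i : ℕ) - (2 * s + 1)).natAbs := by
    refine (two_pow_mul_factorial_le s a).trans (Nat.mul_le_mul
      (Nat.pow_le_pow_left (by omega) _) (prod_le_prod' fun i hi => ?_))
    rw [mem_range] at hi; omega
  calc _ ≤ _ := Nat.mul_le_mul h2 h1
    _ = _ := by ring

/-- The integer `2s + 1` is the offset `λ_0 - λ_1`. Nodes of the same family lie at distances `2|a -
b|` and give exactly the product of factorials on the left; nodes of the other family lie at the odd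
distances `|2(a - b) + 2s + 1|` and give the same up to a power of `2n + 2`. Hence the square. -/
theorem nodeProduct_even_ge {d k s n a : ℕ} (hs : 2 * k + d = 2 * s + 3) (ha : 2 * a ≤ n) :
    ((2 ^ a * a !) * (2 ^ (n / 2 - a) * (n / 2 - a)!)) ^ 2 ≤
      (2 * n + 2) ^ (s + 2) * nodeProduct d k n (2 * a) := by
  have ha' : a ≤ n / 2 := by omega
  rw [nodeProduct_eq_ite d k ha, prod_range_parity, show (n + 1 + 1) / 2 = n / 2 + 1 by omega]
  have he : (∏ i ∈ range (n / 2 + 1), if 2 * i = 2 * a then 1 else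
      (exponent d k (2 * a) - exponent d k (2 * i)).natAbs) =
      (2 ^ a * a !) * (2 ^ (n / 2 - a) * (n / 2 - a)!) := by
    rw [← prod_two_mul_dist ha']
    refine prod_congr rfl fun i _ => ?_
    by_cases h : i = a
    · rw [if_pos (by omega), if_pos h]
    · rw [if_neg (by omega), if_neg h, exponent_even, exponent_even]
      omega
  have ho : (2 ^ a * a !) * (2 ^ (n / 2 - a) * (n / 2 - a)!) ≤ (2 * n + 2) ^ (s + 2) *
      ∏ i ∈ range ((n + 1) / 2), (if 2 * i + 1 = 2 * a then 1 else
      (exponent d k (2 * a) - exponent d k (2 * i + 1)).natAbs) := by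
    rcases Nat.eq_zero_or_pos n with rfl | hn
    · obtain rfl : a = 0 := by omega
      simp [Nat.one_le_pow]
    obtain ⟨N, hN⟩ : ∃ N, (n + 1) / 2 = N + 1 := ⟨(n + 1) / 2 - 1, by omega⟩
    have hp : ∏ i ∈ range (N + 1), (if 2 * i + 1 = 2 * a then 1 else
        (exponent d k (2 * a) - exponent d k (2 * i + 1)).natAbs) =
        ∏ b ∈ range (N + 1), (2 * (a : ℤ) - 2 * b + (2 * s + 1)).natAbs := by
      refine prod_congr rfl fun i _ => ?_
      rw [if_neg (by omega), exponent_even, exponent_odd]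
      omega
    rw [hN, hp]
    -- For even `n` the odd family has one node fewer, so `n / 2 = N + 1`; this accounts for the
    -- exponent `s + 2` in place of `s + 1`.
    have hf : 2 ^ (n / 2 - a) * (n / 2 - a)! ≤ (2 * n + 2) * (2 ^ (N - a) * (N - a)!) := by
      rcases Nat.eq_or_lt_of_le (show n / 2 - a ≤ N - a + 1 by omega) with h | h
      · rw [h, Nat.factorial_succ, pow_succ]
        calc _ = (2 * (N - a + 1)) * (2 ^ (N - a) * (N - a)!) := by ring
          _ ≤ _ := Nat.mul_le_mul_right _ (by omega)
      · have h' : n / 2 - a ≤ N - a := by omega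
        exact (Nat.mul_le_mul (Nat.pow_le_pow_right (by norm_num) h')
          (Nat.factorial_le h')).trans (Nat.le_mul_of_pos_left _ (by omega))
    calc _ ≤ (2 ^ a * a !) * ((2 * n + 2) * (2 ^ (N - a) * (N - a)!)) := Nat.mul_le_mul_left _ hf
      _ = (2 * n + 2) * ((2 ^ a * a !) * (2 ^ (N - a) * (N - a)!)) := by ring
      _ ≤ (2 * n + 2) * ((2 * n + 2) ^ (s + 1) * _) := Nat.mul_le_mul_left _
        ((prod_dist_shift_le s (by omega)).trans (Nat.mul_le_mul_right _
          (Nat.pow_le_pow_left (by omega) _)))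
      _ = _ := by ring
  rw [he, sq, mul_left_comm ((2 * n + 2) ^ (s + 2))]
  exact Nat.mul_le_mul_left _ ho

theorem nodeProduct_odd_ge {d k s n a : ℕ} (hs : 2 * k + d = 2 * s + 3) (ha : 2 * a + 1 ≤ n) :
    ((2 ^ a * a !) * (2 ^ ((n - 1) / 2 - a) * ((n - 1) / 2 - a)!)) ^ 2 ≤
      (2 * n + 2) ^ (s + 2) * nodeProduct d k n (2 * a + 1) := by
  obtain ⟨N, hN⟩ : ∃ N, (n + 1) / 2 = N + 1 := ⟨(n + 1) / 2 - 1, by omega⟩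
  have hN' : (n - 1) / 2 = N := by omega
  rw [nodeProduct_eq_ite d k ha, prod_range_parity, show (n + 1 + 1) / 2 = n / 2 + 1 by omega,
    hN, hN']
  have ho : (∏ i ∈ range (N + 1), if 2 * i + 1 = 2 * a + 1 then 1 else
      (exponent d k (2 * a + 1) - exponent d k (2 * i + 1)).natAbs) =
      (2 ^ a * a !) * (2 ^ (N - a) * (N - a)!) := by
    rw [← prod_two_mul_dist (by omega : a ≤ N)]
    refine prod_congr rfl fun i _ => ?_
    by_cases h : i = a
    · rw [if_pos (by omega), if_pos h]
    · rw [if_neg (by omega), if_neg h, exponent_odd, exponent_odd]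
      omega
  have he : (2 ^ a * a !) * (2 ^ (N - a) * (N - a)!) ≤ (2 * n + 2) ^ (s + 2) *
      ∏ i ∈ range (n / 2 + 1), (if 2 * i = 2 * a + 1 then 1 else
      (exponent d k (2 * a + 1) - exponent d k (2 * i)).natAbs) := by
    have hp : ∏ i ∈ range (n / 2 + 1), (if 2 * i = 2 * a + 1 then 1 else
        (exponent d k (2 * a + 1) - exponent d k (2 * i)).natAbs) =
        ∏ b ∈ range (n / 2 + 1), (2 * (a : ℤ) - 2 * b - (2 * s + 1)).natAbs := by
      refine prod_congr rfl fun i _ => ?_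
      rw [if_neg (by omega), exponent_even, exponent_odd]
      omega
    rw [hp]
    have h' : N - a ≤ n / 2 - a := by omega
    calc _ ≤ (2 ^ a * a !) * (2 ^ (n / 2 - a) * (n / 2 - a)!) := Nat.mul_le_mul_left _
          (Nat.mul_le_mul (Nat.pow_le_pow_right (by norm_num) h') (Nat.factorial_le h'))
      _ ≤ _ := prod_dist_shift_le' s (by omega)
      _ ≤ _ := Nat.mul_le_mul_right _ ((Nat.pow_le_pow_left (by omega) _).trans
          (Nat.pow_le_pow_right (by omega) (by omega)))
  rw [ho, sq, ← mul_assoc ((2 * n + 2) ^ (s + 2))]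
  exact Nat.mul_le_mul_right _ he

/-- Two binomial facts: `choose N a * x^a ≤ (1 + x)^N`, and `(2N)! ≤ (2^N N!)²` because the central
binomial coefficient is at most `4^N`. This is the source of the ratio `1 + x`, hence of the radius
`1/(2τ)`. -/
theorem pow_mul_factorial_le {N a : ℕ} (ha : a ≤ N) {x : ℝ} (hx : 0 ≤ x) :
    x ^ (2 * a) * (2 * N)! ≤
      (1 + x) ^ (2 * N) * (((2 ^ a * a !) * (2 ^ (N - a) * (N - a)!)) ^ 2 : ℕ) := by
  have h1 : (N.choose a : ℝ) * x ^ a ≤ (1 + x) ^ N := by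
    rw [add_comm 1 x, add_pow]
    have := single_le_sum (f := fun m => x ^ m * 1 ^ (N - m) * (N.choose m : ℝ))
      (fun i _ => by positivity) (mem_range.2 (Nat.lt_succ_of_le ha))
    simpa [mul_comm] using this
  have h2 : (2 * N)! ≤ (2 ^ N * N !) ^ 2 := by
    have hc : Nat.centralBinom N * N ! * N ! = (2 * N)! := by
      have := Nat.choose_mul_factorial_mul_factorial (show N ≤ 2 * N by omega)
      rwa [show 2 * N - N = N by omega] at this
    have h4 : Nat.centralBinom N ≤ 2 ^ (2 * N) := by
      rw [Nat.centralBinom_eq_two_mul_choose]; exact Nat.choose_le_two_pow _ _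
    calc (2 * N)! = Nat.centralBinom N * (N ! * N !) := by rw [← hc]; ring
      _ ≤ 2 ^ (2 * N) * (N ! * N !) := Nat.mul_le_mul_right _ h4
      _ = _ := by ring
  have h3 : 2 ^ N * N ! = N.choose a * ((2 ^ a * a !) * (2 ^ (N - a) * (N - a)!)) := by
    rw [← Nat.choose_mul_factorial_mul_factorial ha]
    calc 2 ^ N * (N.choose a * a ! * (N - a)!) =
        2 ^ (a + (N - a)) * (N.choose a * a ! * (N - a)!) := by rw [Nat.add_sub_cancel' ha]
      _ = _ := by ring
  rw [h3] at h2
  have h2' : ((2 * N)! : ℝ) ≤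
      ((N.choose a * ((2 ^ a * a !) * (2 ^ (N - a) * (N - a)!)) : ℕ) : ℝ) ^ 2 := by
    exact_mod_cast h2
  generalize (2 ^ a * a !) * (2 ^ (N - a) * (N - a)!) = T at *
  calc x ^ (2 * a) * (2 * N)! ≤ x ^ (2 * a) * ((N.choose a * T : ℕ) : ℝ) ^ 2 := by gcongr
    _ = (N.choose a * x ^ a) ^ 2 * (T : ℝ) ^ 2 := by push_cast; ring
    _ ≤ ((1 + x) ^ N) ^ 2 * (T : ℝ) ^ 2 := by gcongr
    _ = _ := by push_cast; ring

theorem factorial_le_of_le_add_two {n N : ℕ} (h : n ≤ 2 * N + 2) (h' : 2 * N ≤ n) :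
    n ! ≤ (2 * n + 2) ^ 2 * (2 * N)! := by
  refine (Nat.factorial_le h).trans ?_
  rw [Nat.factorial_succ, Nat.factorial_succ, ← mul_assoc, sq]
  exact Nat.mul_le_mul_right _ (Nat.mul_le_mul (by omega) (by omega))

/-- The main estimate for the fundamental functions. -/
theorem zpow_exponent_div_nodeProduct_le {d k s n j : ℕ} (hs : 2 * k + d = 2 * s + 3)
    (hj : j ≤ n) {x : ℝ} (hx : 0 < x) :
    x ^ exponent d k j * n ! ≤
      (2 * n + 2) ^ (s + 4) * (1 + x) ^ n * (x ^ (exponent d k 0) + x ^ (exponent d k 1)) *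
        nodeProduct d k n j := by
  -- Here `c ∈ {0, 1}` selects the family of `j`, whose lowest exponent is `λ_c`, and `N` is the
  -- largest index within that family. The passage from `n!` to `(2N)!` costs `(2n + 2)²`.
  have key : ∀ (N a c : ℕ), a ≤ N → 2 * N ≤ n → n ≤ 2 * N + 2 →
      ((2 ^ a * a !) * (2 ^ (N - a) * (N - a)!)) ^ 2 ≤
        (2 * n + 2) ^ (s + 2) * nodeProduct d k n j →
      exponent d k j = exponent d k c + (2 * a : ℕ) →
      x ^ exponent d k j * n ! ≤
      (2 * n + 2) ^ (s + 4) * (1 + x) ^ n * x ^ (exponent d k c) * nodeProduct d k n j := by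
    intro N a c ha hN hN' hP hexp
    have h1 := pow_mul_factorial_le ha hx.le
    have h2 : (n ! : ℝ) ≤ (2 * n + 2) ^ 2 * (2 * N)! := by
      exact_mod_cast factorial_le_of_le_add_two hN' hN
    have h3 : ((((2 ^ a * a !) * (2 ^ (N - a) * (N - a)!)) ^ 2 : ℕ) : ℝ) ≤
        (2 * n + 2) ^ (s + 2) * nodeProduct d k n j := by exact_mod_cast hP
    rw [hexp, zpow_add₀ hx.ne', zpow_natCast]
    calc x ^ exponent d k c * x ^ (2 * a) * n !
        ≤ x ^ exponent d k c * x ^ (2 * a) * ((2 * n + 2) ^ 2 * (2 * N)!) := by gcongr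
      _ = x ^ exponent d k c * (2 * n + 2) ^ 2 * (x ^ (2 * a) * (2 * N)!) := by ring
      _ ≤ x ^ exponent d k c * (2 * n + 2) ^ 2 *
          ((1 + x) ^ n * ((2 * n + 2) ^ (s + 2) * nodeProduct d k n j)) := by
        refine mul_le_mul_of_nonneg_left (h1.trans
          (mul_le_mul ?_ h3 (by positivity) (by positivity))) (by positivity)
        exact pow_le_pow_right₀ (by linarith) hN
      _ = _ := by ring
  have h0 : (0 : ℝ) < x ^ exponent d k 0 := zpow_pos hx _
  have h1 : (0 : ℝ) < x ^ exponent d k 1 := zpow_pos hx _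
  obtain ⟨a, rfl | rfl⟩ := Nat.even_or_odd' j
  · refine (key (n / 2) a 0 (by omega) (by omega) (by omega)
      (nodeProduct_even_ge hs hj) ?_).trans ?_
    · rw [exponent_even, show (0 : ℕ) = 2 * 0 from rfl, exponent_even]; push_cast; ring
    · gcongr; linarith
  · refine (key ((n - 1) / 2) a 1 (by omega) (by omega) (by omega)
      (nodeProduct_odd_ge hs hj) ?_).trans ?_
    · rw [exponent_odd, show (1 : ℕ) = 2 * 0 + 1 from rfl, exponent_odd]; push_cast; ring
    · gcongr; linarith

end Polyharmonic

/-! ### Fundamental functions, Taylor's formula and the majorant of the terms. -/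

namespace Polyharmonic

open Finset

/-- The fundamental function `Φ_n(v) = ∑_{j ≤ n} e^{λ_j v} / q_n'(λ_j)`. -/
noncomputable def fundamentalFun (d k n : ℕ) (v : ℝ) : ℂ :=
  ∑ j ∈ range (n + 1), Complex.exp (exponent d k j * v) /
    (Polynomial.derivative (symbolPoly d k n)).eval (exponent d k j : ℂ)

theorem fundamentalFun_zero_apply (d k : ℕ) (v : ℝ) :
    fundamentalFun d k 0 v = Complex.exp (exponent d k 0 * v) := by
  simp [fundamentalFun, eval_derivative_symbolPoly d k le_rfl]

/-- The value is a divided difference: Lagrange interpolation expresses the coefficient of degree `n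
+ 1` of the constant `1` as `∑_j 1 / q_{n+1}'(λ_j)`. -/
theorem fundamentalFun_succ_zero {d : ℕ} (hodd : Odd d) (k n : ℕ) :
    fundamentalFun d k (n + 1) 0 = 0 := by
  have h := Lagrange.coeff_eq_sum (s := range (n + 2)) (v := fun j => (exponent d k j : ℂ))
    (P := 1) (exponent_cast_injective hodd k).injOn
    (by rw [Polynomial.degree_one, card_range]; exact_mod_cast Nat.succ_pos _)
  rw [card_range, Polynomial.coeff_one, if_neg (by omega)] at h
  rw [fundamentalFun, h]
  refine sum_congr rfl fun j hj => ?_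
  rw [eval_derivative_symbolPoly d k (Nat.lt_succ_iff.1 (mem_range.1 hj))]
  simp

theorem hasDerivAt_exp_exponent (d k j : ℕ) (v : ℝ) :
    HasDerivAt (fun v : ℝ => Complex.exp (exponent d k j * v))
      (exponent d k j * Complex.exp (exponent d k j * v)) v := by
  have h := ((hasDerivAt_id v).ofReal_comp.const_mul (exponent d k j : ℂ)).cexp
  simpa [mul_comm] using h

theorem hasDerivAt_fundamentalFun_zero (d k : ℕ) (v : ℝ) :
    HasDerivAt (fundamentalFun d k 0) (exponent d k 0 * fundamentalFun d k 0 v) v := by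
  have h : fundamentalFun d k 0 = fun v : ℝ => Complex.exp (exponent d k 0 * v) :=
    funext (fundamentalFun_zero_apply d k)
  rw [h]
  exact hasDerivAt_exp_exponent d k 0 v

/-- Since `q_{n+1}'(λ_j) = q_n'(λ_j) (λ_j - λ_{n+1})` for `j ≤ n`, writing `λ_j = λ_{n+1} + (λ_j -
λ_{n+1})` splits off `Φ_n`. -/
theorem hasDerivAt_fundamentalFun_succ {d : ℕ} (hodd : Odd d) (k n : ℕ) (v : ℝ) :
    HasDerivAt (fundamentalFun d k (n + 1))
      (exponent d k (n + 1) * fundamentalFun d k (n + 1) v + fundamentalFun d k n v) v := by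
  have h : HasDerivAt (fundamentalFun d k (n + 1))
      (∑ j ∈ range (n + 2), (exponent d k j * Complex.exp (exponent d k j * v)) /
        (Polynomial.derivative (symbolPoly d k (n + 1))).eval (exponent d k j : ℂ)) v :=
    HasDerivAt.fun_sum fun j _ => (hasDerivAt_exp_exponent d k j v).div_const _
  convert h using 1
  rw [fundamentalFun, mul_sum, sum_range_succ, sum_range_succ _ (n + 1), fundamentalFun,
    add_right_comm, ← sum_add_distrib, mul_div_assoc]
  congr 1
  refine sum_congr rfl fun j hj => ?_
  have hjn : j < n + 1 := mem_range.1 hj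
  have hne : (exponent d k j : ℂ) - exponent d k (n + 1) ≠ 0 :=
    sub_ne_zero.2 ((exponent_cast_injective hodd k).ne hjn.ne)
  have hq : (Polynomial.derivative (symbolPoly d k (n + 1))).eval (exponent d k j : ℂ) =
      (Polynomial.derivative (symbolPoly d k n)).eval (exponent d k j : ℂ) *
        (exponent d k j - exponent d k (n + 1)) := by
    rw [eval_derivative_symbolPoly d k hjn.le, eval_derivative_symbolPoly d k (by omega),
      range_add_one (n := n + 1), erase_insert_of_ne hjn.ne', prod_insert (by simp), mul_comm]
  have hq0 : (Polynomial.derivative (symbolPoly d k n)).eval (exponent d k j : ℂ) ≠ 0 := by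
    rw [← norm_ne_zero_iff, norm_eval_derivative_symbolPoly d k (by omega)]
    exact_mod_cast (nodeProduct_pos hodd k n j).ne'
  rw [hq]
  field_simp
  ring

/-- In the variable `t`, the term `λ_n D^{(n)}g Φ_n` produced by differentiating `D^{(n)}g` cancels
the one produced by `Φ_n(v - t)`, and the remaining terms telescope. -/
theorem hasDerivAt_taylorSum {d : ℕ} (hodd : Odd d) (k : ℕ) (g : ℝ → ℂ) {t : ℝ}
    (hg : ∀ n, DifferentiableAt ℝ (genDeriv d k n g) t) (v : ℝ) (N : ℕ) :
    HasDerivAt (fun t => ∑ n ∈ range (N + 1), genDeriv d k n g t * fundamentalFun d k n (v - t))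
      (genDeriv d k (N + 1) g t * fundamentalFun d k N (v - t)) t := by
  have hD : ∀ n, HasDerivAt (genDeriv d k n g)
      (genDeriv d k (n + 1) g t + exponent d k n * genDeriv d k n g t) t := fun n => by
    simpa [genDeriv] using (hg n).hasDerivAt
  have hs : HasDerivAt (fun t => v - t) (-1) t := by
    simpa using (hasDerivAt_id t).const_sub v
  induction N with
  | zero =>
    have h := (hD 0).mul ((hasDerivAt_fundamentalFun_zero d k (v - t)).scomp t hs)
    simp only [zero_add, range_one, sum_singleton]
    refine h.congr_deriv ?_
    simp only [neg_smul, one_smul, Function.comp]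
    ring
  | succ N ih =>
    have h := (hD (N + 1)).mul
      ((hasDerivAt_fundamentalFun_succ hodd k N (v - t)).scomp t hs)
    simp only [sum_range_succ _ (N + 1)]
    refine (ih.add h).congr_deriv ?_
    simp only [neg_smul, one_smul, Function.comp]
    ring

theorem taylorSum_self {d : ℕ} (hodd : Odd d) (k : ℕ) (g : ℝ → ℂ) (v : ℝ) (N : ℕ) :
    ∑ n ∈ range (N + 1), genDeriv d k n g v * fundamentalFun d k n (v - v) = g v := by
  rw [sum_range_succ', sum_eq_zero fun n _ => by rw [sub_self, fundamentalFun_succ_zero hodd,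
    mul_zero]]
  simp [fundamentalFun_zero_apply, genDeriv]

/-- Taylor's formula with respect to the operators `D^{(n)}`, with an estimate of the remainder. -/
theorem norm_sub_taylorSum_le {d : ℕ} (hodd : Odd d) (k : ℕ) (g : ℝ → ℂ) {v₀ v : ℝ}
    (hg : ∀ n, ∀ t ∈ Set.uIcc v₀ v, DifferentiableAt ℝ (genDeriv d k n g) t) (N : ℕ) {B : ℝ}
    (hB : ∀ t ∈ Set.uIcc v₀ v,
      ‖genDeriv d k (N + 1) g t * fundamentalFun d k N (v - t)‖ ≤ B) :
    ‖g v - ∑ n ∈ range (N + 1), genDeriv d k n g v₀ * fundamentalFun d k n (v - v₀)‖ ≤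
      B * ‖v - v₀‖ := by
  -- The mean value inequality in the base point `t`, which moves from `v₀` to `v`; at `t = v` the
  -- Taylor sum is `g v`.
  have h := (convex_uIcc v₀ v).norm_image_sub_le_of_norm_hasDerivWithin_le
    (fun t ht => (hasDerivAt_taylorSum hodd k g (fun n => hg n t ht) v N).hasDerivWithinAt) hB
    Set.left_mem_uIcc Set.right_mem_uIcc
  rwa [taylorSum_self hodd] at h

theorem norm_fundamentalFun_term_le {d k s n j : ℕ} (hodd : Odd d) (hs : 2 * k + d = 2 * s + 3)
    (hj : j ≤ n) {x : ℝ} (hx : 0 < x) :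
    x ^ exponent d k j /
      ‖(Polynomial.derivative (symbolPoly d k n)).eval (exponent d k j : ℂ)‖ ≤
      (2 * n + 2) ^ (s + 4) * (1 + x) ^ n * (x ^ (exponent d k 0) + x ^ (exponent d k 1)) /
        n ! := by
  have hP : (0 : ℝ) < nodeProduct d k n j := by exact_mod_cast nodeProduct_pos hodd k n j
  rw [norm_eval_derivative_symbolPoly d k hj, div_le_div_iff₀ hP (by positivity)]
  exact zpow_exponent_div_nodeProduct_le hs hj hx

theorem norm_exp_exponent (d k j : ℕ) (u : ℝ) :
    ‖Complex.exp (exponent d k j * u)‖ = Real.exp u ^ exponent d k j := by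
  rw [Complex.exp_int_mul, norm_zpow, ← Complex.ofReal_exp, Complex.norm_real,
    Real.norm_of_nonneg (Real.exp_pos u).le]

theorem norm_fundamentalFun_le {d k s : ℕ} (hodd : Odd d) (hs : 2 * k + d = 2 * s + 3)
    (n : ℕ) (u : ℝ) :
    ‖fundamentalFun d k n u‖ ≤ (2 * n + 2) ^ (s + 5) * (1 + Real.exp u) ^ n *
      (Real.exp u ^ (exponent d k 0) + Real.exp u ^ (exponent d k 1)) / n ! := by
  set A := (Real.exp u ^ (exponent d k 0) + Real.exp u ^ (exponent d k 1)) with hA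
  have hA0 : 0 ≤ A := by positivity
  calc ‖fundamentalFun d k n u‖
      ≤ ∑ j ∈ range (n + 1), (2 * n + 2) ^ (s + 4) * (1 + Real.exp u) ^ n * A / n ! := by
        refine norm_sum_le_of_le _ fun j hj => ?_
        rw [norm_div, norm_exp_exponent]
        exact norm_fundamentalFun_term_le hodd hs (Nat.lt_succ_iff.1 (mem_range.1 hj))
          (Real.exp_pos u)
    _ = (n + 1) * ((2 * n + 2) ^ (s + 4) * (1 + Real.exp u) ^ n * A / n !) := by
        rw [sum_const, card_range, nsmul_eq_mul]; push_cast; rfl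
    _ ≤ (2 * n + 2) * ((2 * n + 2) ^ (s + 4) * (1 + Real.exp u) ^ n * A / n !) := by
        refine mul_le_mul_of_nonneg_right (by linarith) (by positivity)
    _ = _ := by ring

theorem seriesTerm_exp (d k : ℕ) (g : ℝ → ℂ) (v₀ v : ℝ) (n : ℕ) :
    ∑ j ∈ range (n + 1), seriesTerm d k g v₀ n j (Real.exp v : ℂ) =
      genDeriv d k n (fun v => g (Real.exp v)) v₀ * fundamentalFun d k n (v - v₀) := by
  rw [fundamentalFun, mul_sum]
  refine sum_congr rfl fun j _ => ?_
  rw [seriesTerm, Complex.ofReal_exp, ← Complex.exp_int_mul, mul_assoc, div_mul_eq_mul_div,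
    ← Complex.exp_add]
  push_cast
  ring_nf

/-- Weierstrass majorant for the terms of the double series. -/
theorem norm_seriesTerm_le {d k s : ℕ} (hodd : Odd d) (hs : 2 * k + d = 2 * s + 3)
    (g : ℝ → ℂ) (v₀ : ℝ) {n j : ℕ} (hj : j ≤ n) {z : ℂ} (hz : z ≠ 0) {C σ : ℝ}
    (hC : ‖genDeriv d k n (fun v => g (Real.exp v)) v₀‖ ≤
      C * (n + 2)! * (σ * Real.exp v₀) ^ n) :
    ‖seriesTerm d k g v₀ n j z‖ ≤ C * (2 * n + 2) ^ (s + 6) *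
      (σ * (Real.exp v₀ + ‖z‖)) ^ n *
      ((‖z‖ / Real.exp v₀) ^ (exponent d k 0) + (‖z‖ / Real.exp v₀) ^ (exponent d k 1)) := by
  have hρ := Real.exp_pos v₀
  have hx : 0 < ‖z‖ / Real.exp v₀ := div_pos (norm_pos_iff.2 hz) hρ
  have h := norm_fundamentalFun_term_le hodd hs hj hx
  set A := ((‖z‖ / Real.exp v₀) ^ (exponent d k 0) + (‖z‖ / Real.exp v₀) ^ (exponent d k 1))
  have hA : 0 ≤ A := by positivity
  have hterm : ‖seriesTerm d k g v₀ n j z‖ = ‖genDeriv d k n (fun v => g (Real.exp v)) v₀‖ *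
      ((‖z‖ / Real.exp v₀) ^ exponent d k j /
      ‖(Polynomial.derivative (symbolPoly d k n)).eval (exponent d k j : ℂ)‖) := by
    have he : ‖Complex.exp (-(exponent d k j : ℂ) * v₀)‖ =
        (Real.exp v₀ ^ exponent d k j)⁻¹ := by
      rw [neg_mul, Complex.exp_neg, norm_inv, norm_exp_exponent]
    rw [seriesTerm, norm_mul, norm_mul, norm_div, norm_zpow, he, div_zpow]
    ring
  have hfac : ((n + 2)! : ℝ) ≤ (2 * n + 2) ^ 2 * n ! := by
    have : (n + 2)! ≤ (2 * n + 2) ^ 2 * n ! := by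
      rw [Nat.factorial_succ, Nat.factorial_succ, ← mul_assoc]
      exact Nat.mul_le_mul_right _ (by nlinarith)
    exact_mod_cast this
  have hCn : 0 ≤ C * (n + 2)! * (σ * Real.exp v₀) ^ n := (norm_nonneg _).trans hC
  have hCn' : 0 ≤ C * (σ * Real.exp v₀) ^ n := by
    have : (0 : ℝ) < (n + 2)! := by positivity
    rw [mul_right_comm] at hCn
    exact nonneg_of_mul_nonneg_left hCn this
  rw [hterm]
  calc _ ≤ C * (n + 2)! * (σ * Real.exp v₀) ^ n *
        ((2 * n + 2) ^ (s + 4) * (1 + ‖z‖ / Real.exp v₀) ^ n * A / n !) :=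
        mul_le_mul hC h (by positivity) hCn
    _ = (C * (σ * Real.exp v₀) ^ n) *
        ((2 * n + 2) ^ (s + 4) * (1 + ‖z‖ / Real.exp v₀) ^ n * A / n !) * (n + 2)! := by ring
    _ ≤ (C * (σ * Real.exp v₀) ^ n) *
        ((2 * n + 2) ^ (s + 4) * (1 + ‖z‖ / Real.exp v₀) ^ n * A / n !) *
          ((2 * n + 2) ^ 2 * n !) := by gcongr
    _ = C * (2 * n + 2) ^ (s + 6) *
        ((σ * Real.exp v₀) ^ n * (1 + ‖z‖ / Real.exp v₀) ^ n) * A := by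
        field_simp; ring
    _ = _ := by
        have hz' : σ * Real.exp v₀ * (1 + ‖z‖ / Real.exp v₀) = σ * (Real.exp v₀ + ‖z‖) := by
          field_simp
        rw [← mul_pow, hz']

theorem summable_pow_mul_geometric (m : ℕ) {θ : ℝ} (h0 : 0 ≤ θ) (h1 : θ < 1) :
    Summable fun n : ℕ => ((2 * n + 2 : ℝ) ^ m) * θ ^ n := by
  rcases h0.eq_or_lt with rfl | h0
  · refine summable_of_ne_finset_zero (s := {0}) fun n hn => ?_
    rw [zero_pow (by simpa using hn), mul_zero]
  have h := (summable_nat_add_iff 1).2 (summable_pow_mul_geometric_of_norm_lt_one (R := ℝ) m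
    (r := θ) (by rwa [Real.norm_of_nonneg h0.le]))
  refine (h.mul_left (2 ^ m * θ⁻¹)).congr fun n => ?_
  push_cast
  rw [show (2 * n + 2 : ℝ) = 2 * (n + 1) by ring, mul_pow, pow_succ]
  field_simp

end Polyharmonic

/-! ### Rotations of the sphere and the radial-angular splitting of the Laplacian. -/

namespace Polyharmonic

open MeasureTheory Metric
open scoped Pointwise

/-- Differentiation under the integral sign over a compact space. -/
theorem hasDerivAt_integral_of_continuousOn {X : Type*} [TopologicalSpace X] [CompactSpace X]
    [MeasurableSpace X] [OpensMeasurableSpace X] {μ : Measure X} [IsFiniteMeasure μ]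
    {F F' : ℝ → X → ℂ} {U : Set ℝ} (hU : IsOpen U) (hF : ∀ t ∈ U, Continuous (F t))
    (hF' : ContinuousOn (Function.uncurry F') (U ×ˢ Set.univ))
    (h : ∀ t ∈ U, ∀ x, HasDerivAt (fun t => F t x) (F' t x) t) {t : ℝ} (ht : t ∈ U) :
    HasDerivAt (fun t => ∫ x, F t x ∂μ) (∫ x, F' t x ∂μ) t := by
  obtain ⟨ε, hε, hεU⟩ := nhds_basis_closedBall.mem_iff.1 (hU.mem_nhds ht)
  obtain ⟨C, hC⟩ := ((isCompact_closedBall t ε).prod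
    (isCompact_univ (X := X))).exists_bound_of_continuousOn (hF'.mono (Set.prod_mono hεU le_rfl))
  have hF't : Continuous (F' t) := by
    rw [← continuousOn_univ]
    exact hF'.comp (f := fun x => (t, x)) (by fun_prop) fun x _ => ⟨ht, trivial⟩
  exact (hasDerivAt_integral_of_dominated_loc_of_deriv_le (bound := fun _ => C)
    (closedBall_mem_nhds t hε)
    ((hU.mem_nhds ht |> Filter.eventually_of_mem) fun s hs => (hF s hs).aestronglyMeasurable)
    ((hF t ht).integrable_of_hasCompactSupport (HasCompactSupport.of_compactSpace _))
    hF't.aestronglyMeasurable (.of_forall fun x s hs => hC (s, x) ⟨hs, trivial⟩)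
    (integrable_const _) (.of_forall fun x s hs => h s (hεU hs) x)).2

section Sphere

variable {d : ℕ}

local notation "𝔼" => EuclideanSpace ℝ (Fin d)

instance : IsFiniteMeasure (surfaceMeasure d) := by
  unfold surfaceMeasure; infer_instance

/-- The action of a linear isometry on the unit sphere. -/
noncomputable def sphereMap (e : 𝔼 ≃ₗᵢ[ℝ] 𝔼) (θ : sphere (0 : 𝔼) 1) : sphere (0 : 𝔼) 1 :=
  ⟨e θ, by simp⟩

/-- The surface measure of `s` is a multiple of the volume of the cone `(0,1) • s`; isometries map
cones to cones and preserve volume. -/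
theorem measurePreserving_sphereMap (e : 𝔼 ≃ₗᵢ[ℝ] 𝔼) :
    MeasurePreserving (sphereMap e) (surfaceMeasure d) (surfaceMeasure d) := by
  have hm : Measurable (sphereMap e) :=
    Continuous.measurable (Continuous.subtype_mk (e.continuous.comp continuous_subtype_val) _)
  refine ⟨hm, Measure.ext fun s hs => ?_⟩
  rw [Measure.map_apply hm hs, surfaceMeasure, Measure.toSphere_apply' _ (hm hs),
    Measure.toSphere_apply' _ hs]
  congr 1
  have himg : (Set.Ioo (0 : ℝ) 1 • ((↑) '' (sphereMap e ⁻¹' s) : Set 𝔼)) =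
      e ⁻¹' (Set.Ioo (0 : ℝ) 1 • ((↑) '' s : Set 𝔼)) := by
    ext x
    simp only [Set.mem_smul, Set.mem_image, Set.mem_preimage]
    constructor
    · rintro ⟨c, hc, _, ⟨θ, hθ, rfl⟩, rfl⟩
      exact ⟨c, hc, _, ⟨_, hθ, rfl⟩, by simp [sphereMap]⟩
    · rintro ⟨c, hc, _, ⟨θ, hθ, rfl⟩, hx⟩
      refine ⟨c, hc, _, ⟨sphereMap e.symm θ, ?_, rfl⟩, ?_⟩
      · convert hθ
        ext1
        simp [sphereMap]
      · apply e.injective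
        rw [← hx]
        simp [sphereMap]
  rw [himg]
  exact e.measurePreserving.measure_preimage_equiv (f := e.toMeasurableEquiv) _

theorem continuous_comp_sphere {F : Type*} [TopologicalSpace F] {h : 𝔼 → F} {G : Set 𝔼}
    (hh : ContinuousOn h G) {r : ℝ} (hr : ∀ θ : sphere (0 : 𝔼) 1, r • (θ : 𝔼) ∈ G) :
    Continuous fun θ : sphere (0 : 𝔼) 1 => h (r • (θ : 𝔼)) := by
  rw [← continuousOn_univ]
  exact hh.comp (f := fun θ : sphere (0 : 𝔼) 1 => r • (θ : 𝔼)) (by fun_prop) fun θ _ => hr θ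

theorem integrable_sphere {h : sphere (0 : 𝔼) 1 → ℂ} (hh : Continuous h) :
    Integrable h (surfaceMeasure d) :=
  hh.integrable_of_hasCompactSupport (HasCompactSupport.of_compactSpace _)

/-- The derivative of `h` along the linear vector field `A`. -/
noncomputable def linDeriv (A : 𝔼 →L[ℝ] 𝔼) (h : 𝔼 → ℂ) (x : 𝔼) : ℂ := fderiv ℝ h x (A x)

theorem ContDiffOn.linDeriv {h : 𝔼 → ℂ} {G : Set 𝔼} (hG : IsOpen G)
    (hh : ContDiffOn ℝ ∞ h G) (A : 𝔼 →L[ℝ] 𝔼) : ContDiffOn ℝ ∞ (linDeriv A h) G :=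
  (hh.fderiv_of_isOpen hG le_rfl).clm_apply A.contDiff.contDiffOn

/-- A skew-adjoint `A` generates the rotations `exp(tA)`. The integral of `h` over the rotated
sphere does not depend on `t`, and its derivative at `t = 0` is the integral in question. -/
theorem integral_linDeriv_eq_zero {G : Set 𝔼} (hG : IsOpen G) {h : 𝔼 → ℂ}
    (hh : ContDiffOn ℝ ∞ h G) {r : ℝ} (hr : ∀ θ : sphere (0 : 𝔼) 1, r • (θ : 𝔼) ∈ G)
    {A : 𝔼 →L[ℝ] 𝔼} (hA : A ∈ skewAdjoint (𝔼 →L[ℝ] 𝔼)) :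
    ∫ θ : sphere (0 : 𝔼) 1, linDeriv A h (r • (θ : 𝔼)) ∂(surfaceMeasure d) = 0 := by
  let _ : NormedAlgebra ℚ (𝔼 →L[ℝ] 𝔼) := .restrictScalars ℚ ℝ _
  have hU : ∀ t : ℝ, NormedSpace.exp (t • A) ∈ unitary (𝔼 →L[ℝ] 𝔼) := fun t =>
    NormedSpace.exp_mem_unitary_of_mem_skewAdjoint (skewAdjoint.smul_mem t hA)
  let R : ℝ → (𝔼 ≃ₗᵢ[ℝ] 𝔼) := fun t => Unitary.linearIsometryEquiv ⟨_, hU t⟩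
  have hR : ∀ t x, R t x = NormedSpace.exp (t • A) x := fun t x => rfl
  have hmem : ∀ t, ∀ θ : sphere (0 : 𝔼) 1, r • R t θ ∈ G := fun t θ => hr (sphereMap (R t) θ)
  have hcont : Continuous fun p : ℝ × sphere (0 : 𝔼) 1 => r • R p.1 p.2 := by
    have h1 : Continuous fun t : ℝ => NormedSpace.exp (t • A) := by
      fun_prop
    simp only [hR]
    exact ((h1.comp continuous_fst).clm_apply
      (continuous_subtype_val.comp continuous_snd)).const_smul r
  have hdR : ∀ (t : ℝ) (x : 𝔼), HasDerivAt (fun t => r • R t x) (A (r • R t x)) t := by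
    intro t x
    have h1 := hasDerivAt_exp_smul_const' (𝕂 := ℝ) A t
    have h2 := (h1.clm_apply (hasDerivAt_const t x)).const_smul r
    refine h2.congr_deriv ?_
    simp [hR]
  have key := hasDerivAt_integral_of_continuousOn (μ := surfaceMeasure d) isOpen_univ
    (F := fun t (θ : sphere (0 : 𝔼) 1) => h (r • R t θ))
    (F' := fun t (θ : sphere (0 : 𝔼) 1) => linDeriv A h (r • R t θ))
    (fun t _ => by
      have := (continuous_comp_sphere hh.continuousOn hr)
      exact this.comp (f := sphereMap (R t))
        (Continuous.subtype_mk ((R t).continuous.comp continuous_subtype_val) _))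
    (by
      exact (ContDiffOn.linDeriv hG hh A).continuousOn.comp hcont.continuousOn
        fun p _ => hmem p.1 p.2)
    (fun t _ θ => by
      have hd : HasFDerivAt h (fderiv ℝ h (r • R t θ)) (r • R t θ) :=
        ((hh.differentiableOn (by simp)).differentiableAt (hG.mem_nhds (hmem t θ))).hasFDerivAt
      exact hd.comp_hasDerivAt t (hdR t θ))
    (Set.mem_univ 0)
  have hconst : ∀ t, ∫ θ : sphere (0 : 𝔼) 1, h (r • R t θ) ∂(surfaceMeasure d) =
      ∫ θ : sphere (0 : 𝔼) 1, h (r • (θ : 𝔼)) ∂(surfaceMeasure d) := by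
    intro t
    have hme : MeasurableEmbedding (sphereMap (R t)) := by
      refine MeasurableEmbedding.of_measurable_inverse (g := sphereMap (R t).symm)
        (measurePreserving_sphereMap _).measurable ?_ (measurePreserving_sphereMap _).measurable ?_
      · convert MeasurableSet.univ
        exact Set.range_eq_univ.2 fun θ => ⟨sphereMap (R t).symm θ, by ext1; simp [sphereMap]⟩
      · intro θ; ext1; simp [sphereMap]
    exact (measurePreserving_sphereMap (R t)).integral_comp hme
      (fun θ : sphere (0 : 𝔼) 1 => h (r • (θ : 𝔼)))
  simp only [hconst] at key
  have h0 := key.unique (hasDerivAt_const (0 : ℝ) _)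
  have hR0 : ∀ x, R 0 x = x := fun x => by
    rw [hR, zero_smul ℝ A, NormedSpace.exp_zero]; rfl
  simpa only [hR0] using h0

theorem linDeriv_linDeriv {h : 𝔼 → ℂ} {x : 𝔼} (hh : ContDiffAt ℝ 2 h x) (A : 𝔼 →L[ℝ] 𝔼) :
    linDeriv A (linDeriv A h) x =
      fderiv ℝ (fderiv ℝ h) x (A x) (A x) + fderiv ℝ h x (A (A x)) := by
  have h1 : DifferentiableAt ℝ (fderiv ℝ h) x :=
    (hh.fderiv_right (m := 1) (by norm_num)).differentiableAt (by simp)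
  have h2 := h1.hasFDerivAt.clm_apply A.hasFDerivAt
  have h3 : fderiv ℝ (linDeriv A h) x = _ := h2.fderiv
  rw [linDeriv, h3]
  simp [add_comm]

/-- The cross terms cancel, so that `L²f·w - f·L²w` is a single derivative along `A`, whose integral
over a sphere vanishes when `A` is skew-adjoint. -/
theorem linDeriv_mul_sub {f w : 𝔼 → ℂ} {x : 𝔼} (hf : ContDiffAt ℝ 2 f x)
    (hw : ContDiffAt ℝ 2 w x) (A : 𝔼 →L[ℝ] 𝔼) :
    linDeriv A (fun y => linDeriv A f y * w y - f y * linDeriv A w y) x =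
      linDeriv A (linDeriv A f) x * w x - f x * linDeriv A (linDeriv A w) x := by
  have hd : ∀ {h : 𝔼 → ℂ}, ContDiffAt ℝ 2 h x → DifferentiableAt ℝ (linDeriv A h) x := by
    intro h hh
    exact ((hh.fderiv_right (m := 1) (by norm_num)).differentiableAt (by simp)).clm_apply
      A.differentiableAt
  have hf1 := (hf.differentiableAt (by simp)).hasFDerivAt
  have hw1 := (hw.differentiableAt (by simp)).hasFDerivAt
  have h := ((hd hf).hasFDerivAt.mul hw1).sub (hf1.mul (hd hw).hasFDerivAt)
  have h3 : fderiv ℝ (fun y => linDeriv A f y * w y - f y * linDeriv A w y) x = _ := h.fderiv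
  rw [linDeriv, h3]
  simp [linDeriv]
  ring

/-- The linear vector fields generating rotations are symmetric up to sign on spheres. -/
theorem integral_linDeriv_linDeriv_mul {G : Set 𝔼} (hG : IsOpen G) {f w : 𝔼 → ℂ}
    (hf : ContDiffOn ℝ ∞ f G) (hw : ContDiff ℝ ∞ w) {r : ℝ}
    (hr : ∀ θ : sphere (0 : 𝔼) 1, r • (θ : 𝔼) ∈ G)
    {A : 𝔼 →L[ℝ] 𝔼} (hA : A ∈ skewAdjoint (𝔼 →L[ℝ] 𝔼)) :
    ∫ θ : sphere (0 : 𝔼) 1, linDeriv A (linDeriv A f) (r • (θ : 𝔼)) * w (r • (θ : 𝔼))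
        ∂(surfaceMeasure d) =
      ∫ θ : sphere (0 : 𝔼) 1, f (r • (θ : 𝔼)) * linDeriv A (linDeriv A w) (r • (θ : 𝔼))
        ∂(surfaceMeasure d) := by
  have hwG : ContDiffOn ℝ ∞ w G := hw.contDiffOn
  have hf' := ContDiffOn.linDeriv hG hf A
  have hw' := ContDiffOn.linDeriv hG hwG A
  have h0 := integral_linDeriv_eq_zero hG ((hf'.mul hwG).sub (hf.mul hw')) hr hA
  have hi1 := integrable_sphere (continuous_comp_sphere
    ((ContDiffOn.linDeriv hG hf' A).mul hwG).continuousOn hr)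
  have hi2 := integrable_sphere (continuous_comp_sphere
    (hf.mul (ContDiffOn.linDeriv hG hw' A)).continuousOn hr)
  rw [← sub_eq_zero, ← integral_sub hi1 hi2, ← h0]
  refine integral_congr_ae (.of_forall fun θ => ?_)
  exact (linDeriv_mul_sub ((hf.contDiffAt (hG.mem_nhds (hr θ))).of_le (by norm_cast))
    (hw.contDiffAt.of_le (by norm_cast)) A).symm

/-- The generator `x ↦ x_i e_j - x_j e_i` of the rotations in a coordinate plane. -/
noncomputable def rotGen (i j : Fin d) : 𝔼 →L[ℝ] 𝔼 :=
  (EuclideanSpace.proj i : 𝔼 →L[ℝ] ℝ).smulRight (EuclideanSpace.single j (1 : ℝ)) -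
    (EuclideanSpace.proj j : 𝔼 →L[ℝ] ℝ).smulRight (EuclideanSpace.single i (1 : ℝ))

theorem rotGen_apply (i j : Fin d) (x : 𝔼) : rotGen i j x =
    x i • EuclideanSpace.single j (1 : ℝ) - x j • EuclideanSpace.single i (1 : ℝ) := rfl

theorem rotGen_mem_skewAdjoint (i j : Fin d) :
    (rotGen i j : 𝔼 →L[ℝ] 𝔼) ∈ skewAdjoint (𝔼 →L[ℝ] 𝔼) := by
  rw [skewAdjoint.mem_iff, eq_comm, ContinuousLinearMap.star_eq_adjoint,
    ContinuousLinearMap.eq_adjoint_iff]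
  intro x y
  simp only [_root_.neg_apply, rotGen_apply, inner_neg_left, inner_sub_left,
    inner_sub_right, inner_smul_left, inner_smul_right, EuclideanSpace.inner_single_left,
    EuclideanSpace.inner_single_right]
  simp
  ring

theorem sum_smul_single (x : 𝔼) : ∑ i, x i • EuclideanSpace.single i (1 : ℝ) = x := by
  simpa using (EuclideanSpace.basisFun (Fin d) ℝ).sum_repr x

theorem laplacian_apply (f : 𝔼 → ℂ) (x : 𝔼) :
    Δ f x = ∑ i, fderiv ℝ (fderiv ℝ f) x (EuclideanSpace.single i 1)
      (EuclideanSpace.single i 1) := by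
  rw [InnerProductSpace.laplacian_eq_iteratedFDeriv_orthonormalBasis f
    (EuclideanSpace.basisFun (Fin d) ℝ)]
  simp [iteratedFDeriv_two_apply]

theorem ContDiffOn.laplacian {f : 𝔼 → ℂ} {G : Set 𝔼} (hG : IsOpen G)
    (hf : ContDiffOn ℝ ∞ f G) : ContDiffOn ℝ ∞ (Δ f) G := by
  have h2 := (hf.fderiv_of_isOpen hG le_rfl).fderiv_of_isOpen (m := ∞) hG le_rfl
  have h3 : ContDiffOn ℝ ∞ (fun x => ∑ i, fderiv ℝ (fderiv ℝ f) x (EuclideanSpace.single i 1)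
      (EuclideanSpace.single i 1)) G :=
    ContDiffOn.sum fun i _ => (h2.clm_apply contDiffOn_const).clm_apply contDiffOn_const
  exact h3.congr fun x _ => laplacian_apply f x

/-- A Lagrange identity, to be applied to the Hessian. The sum runs over ordered pairs and counts
each coordinate plane twice, whence the factor `2` here and the `2⁻¹` in `norm_sq_mul_laplacian`. -/
theorem sum_bilin_rotGen (B : 𝔼 →L[ℝ] 𝔼 →L[ℝ] ℂ) (x : 𝔼) :
    ∑ i, ∑ j, B (rotGen i j x) (rotGen i j x) =
      2 * ((‖x‖ ^ 2 : ℝ) * ∑ i, B (EuclideanSpace.single i 1) (EuclideanSpace.single i 1) -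
        B x x) := by
  have hB : B x x = ∑ i, ∑ j, (x i : ℂ) * (x j : ℂ) *
      B (EuclideanSpace.single i 1) (EuclideanSpace.single j 1) := by
    conv_lhs => rw [← sum_smul_single x]
    simp only [map_sum, map_smul, _root_.sum_apply, _root_.smul_apply,
      Finset.smul_sum, Complex.real_smul]
    rw [Finset.sum_comm]
    refine Finset.sum_congr rfl fun i _ => Finset.sum_congr rfl fun j _ => by ring
  have hn : ((‖x‖ ^ 2 : ℝ) : ℂ) = ∑ i, (x i : ℂ) ^ 2 := by
    rw [EuclideanSpace.norm_sq_eq]; simp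
  set b : Fin d → Fin d → ℂ := fun i j =>
    B (EuclideanSpace.single i 1) (EuclideanSpace.single j 1) with hb
  have hterm : ∀ i j, B (rotGen i j x) (rotGen i j x) =
      (x i : ℂ) ^ 2 * b j j + (x j : ℂ) ^ 2 * b i i - (x i : ℂ) * x j * b i j
        - (x j : ℂ) * x i * b j i := by
    intro i j
    simp only [rotGen_apply, map_sub, map_smul, _root_.sub_apply,
      _root_.smul_apply, Complex.real_smul, hb]
    ring
  simp only [hterm, Finset.sum_sub_distrib, Finset.sum_add_distrib]
  rw [hB, hn, Finset.sum_comm (f := fun i j => (x j : ℂ) ^ 2 * b i i),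
    Finset.sum_comm (f := fun i j => (x j : ℂ) * x i * b j i), Finset.sum_mul_sum]
  ring

theorem sum_rotGen_rotGen (x : 𝔼) :
    ∑ i, ∑ j, rotGen i j (rotGen i j x) = (-2 * ((d : ℝ) - 1)) • x := by
  have hterm : ∀ i j : Fin d, rotGen i j (rotGen i j x) =
      (if i = j then x i • EuclideanSpace.single j (1 : ℝ) else 0) -
        x j • EuclideanSpace.single j (1 : ℝ) - x i • EuclideanSpace.single i (1 : ℝ) +
        (if i = j then x j • EuclideanSpace.single i (1 : ℝ) else 0) := by
    intro i j
    rw [rotGen_apply i j (rotGen i j x), rotGen_apply]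
    by_cases h : i = j
    · subst h; simp
    · simp [h, Ne.symm h, sub_eq_add_neg, add_comm]
  simp only [hterm, Finset.sum_sub_distrib, Finset.sum_add_distrib, Finset.sum_ite_eq,
    Finset.mem_univ, if_true, Finset.sum_const, Finset.card_univ, Fintype.card_fin,
    sum_smul_single, ← Finset.smul_sum, ← Nat.cast_smul_eq_nsmul ℝ]
  module

/-- Decomposition of the Laplacian into its radial and angular parts. -/
theorem norm_sq_mul_laplacian {f : 𝔼 → ℂ} {x : 𝔼} (hf : ContDiffAt ℝ 2 f x) :
    (‖x‖ ^ 2 : ℝ) * Δ f x =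
      linDeriv (.id ℝ 𝔼) (linDeriv (.id ℝ 𝔼) f) x + (d - 2) * linDeriv (.id ℝ 𝔼) f x +
        2⁻¹ * ∑ i, ∑ j, linDeriv (rotGen i j) (linDeriv (rotGen i j) f) x := by
  simp only [linDeriv_linDeriv hf, Finset.sum_add_distrib]
  rw [sum_bilin_rotGen, laplacian_apply]
  have h : ∑ i, ∑ j, fderiv ℝ f x (rotGen i j (rotGen i j x)) =
      -2 * (d - 1) * fderiv ℝ f x x := by
    simp only [← map_sum]
    rw [sum_rotGen_rotGen, map_smul, Complex.real_smul]
    push_cast; ring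
  rw [h]
  simp only [linDeriv, ContinuousLinearMap.id_apply]
  ring

end Sphere

end Polyharmonic

/-! ### Harmonic polynomials and the radial equation of the coefficients. -/

namespace Polyharmonic

open MeasureTheory Metric

section Polynomial

variable {d : ℕ}

local notation "𝔼" => EuclideanSpace ℝ (Fin d)

theorem contDiff_evalReal (P : MvPolynomial (Fin d) ℂ) : ContDiff ℝ ∞ (evalReal P) := by
  induction P using MvPolynomial.induction_on with
  | C a =>
    have h : evalReal (MvPolynomial.C a : MvPolynomial (Fin d) ℂ) = fun _ => a := by
      ext x; simp [evalReal]
    rw [h]; exact contDiff_const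
  | add p q hp hq =>
    have h : evalReal (p + q) = fun x => evalReal p x + evalReal q x := by
      ext x; simp [evalReal]
    rw [h]; exact hp.add hq
  | mul_X p i hp =>
    have h : evalReal (p * MvPolynomial.X i) = fun x => evalReal p x * ((x i : ℝ) : ℂ) := by
      ext x; simp [evalReal]
    rw [h]
    exact hp.mul ((Complex.ofRealCLM.comp (EuclideanSpace.proj i : 𝔼 →L[ℝ] ℝ)).contDiff)

theorem fderiv_evalReal (P : MvPolynomial (Fin d) ℂ) (x : 𝔼) (i : Fin d) :
    fderiv ℝ (evalReal P) x (EuclideanSpace.single i 1) =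
      evalReal (MvPolynomial.pderiv i P) x := by
  have hd : ∀ P : MvPolynomial (Fin d) ℂ, HasFDerivAt (evalReal P) (fderiv ℝ (evalReal P) x) x :=
    fun P => ((contDiff_evalReal P).differentiable (by simp) x).hasFDerivAt
  induction P using MvPolynomial.induction_on with
  | C a =>
    have h : evalReal (MvPolynomial.C a : MvPolynomial (Fin d) ℂ) = fun _ => a := by
      ext x; simp [evalReal]
    rw [h]; simp [evalReal]
  | add p q hp hq =>
    have h : evalReal (p + q) = fun x => evalReal p x + evalReal q x := by
      ext x; simp [evalReal]
    have h2 : fderiv ℝ (fun x => evalReal p x + evalReal q x) x = _ := ((hd p).add (hd q)).fderiv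
    rw [h, h2, _root_.add_apply, hp, hq]
    simp [evalReal]
  | mul_X p j hp =>
    have h : evalReal (p * MvPolynomial.X j) = fun x => evalReal p x * ((x j : ℝ) : ℂ) := by
      ext x; simp [evalReal]
    have h2 : fderiv ℝ (fun x : 𝔼 => evalReal p x * ((x j : ℝ) : ℂ)) x = _ :=
      ((hd p).mul (Complex.ofRealCLM.comp
        (EuclideanSpace.proj j : 𝔼 →L[ℝ] ℝ)).hasFDerivAt).fderiv
    rw [h, h2]
    simp only [_root_.add_apply, _root_.smul_apply, hp]
    by_cases hij : i = j
    · subst hij; simp [evalReal]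
    · simp [evalReal, MvPolynomial.pderiv_X_of_ne (Ne.symm hij), Ne.symm hij, mul_comm]

theorem laplacian_evalReal (P : MvPolynomial (Fin d) ℂ) (x : 𝔼) :
    Δ (evalReal P) x = evalReal (∑ i, MvPolynomial.pderiv i (MvPolynomial.pderiv i P)) x := by
  rw [laplacian_apply, evalReal, map_sum]
  refine Finset.sum_congr rfl fun i _ => ?_
  have h1 : DifferentiableAt ℝ (fderiv ℝ (evalReal P)) x :=
    (((contDiff_evalReal P).contDiffAt (x := x)).fderiv_right (m := 1)
      (by norm_cast)).differentiableAt (by simp)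
  have h2 := h1.hasFDerivAt.clm_apply (hasFDerivAt_const (EuclideanSpace.single i (1 : ℝ)) x)
  have h3 : fderiv ℝ (evalReal (MvPolynomial.pderiv i P)) x = _ :=
    (h2.congr_of_eventuallyEq (.of_forall fun y => (fderiv_evalReal P y i).symm)).fderiv
  rw [← evalReal, ← fderiv_evalReal, h3]
  simp

theorem evalReal_smul {P : MvPolynomial (Fin d) ℂ} {k : ℕ} (hP : P.IsHomogeneous k) (c : ℝ)
    (x : 𝔼) : evalReal P (c • x) = (c : ℂ) ^ k * evalReal P x := by
  rw [evalReal, evalReal, MvPolynomial.eval_eq', MvPolynomial.eval_eq', Finset.mul_sum]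
  refine Finset.sum_congr rfl fun m hm => ?_
  have hk : ∑ i, m i = k := by
    have := hP (MvPolynomial.mem_support_iff.1 hm)
    simpa [Finsupp.weight_apply, Finsupp.sum_fintype] using this
  simp only [PiLp.smul_apply, smul_eq_mul, Complex.ofReal_mul, mul_pow, Finset.prod_mul_distrib,
    Finset.prod_pow_eq_pow_sum, hk]
  ring

/-- Euler's identity: differentiate `P(cx) = c^k P(x)` at `c = 1`. -/
theorem linDeriv_id_evalReal {P : MvPolynomial (Fin d) ℂ} {k : ℕ} (hP : P.IsHomogeneous k)
    (x : 𝔼) : linDeriv (.id ℝ 𝔼) (evalReal P) x = k * evalReal P x := by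
  have h1 : HasFDerivAt (evalReal P) (fderiv ℝ (evalReal P) x) ((1 : ℝ) • x) := by
    rw [one_smul]; exact ((contDiff_evalReal P).differentiable (by simp) x).hasFDerivAt
  have h2 := h1.comp_hasDerivAt (1 : ℝ) ((hasDerivAt_id (1 : ℝ)).smul_const x)
  have h3 : HasDerivAt (fun c : ℝ => (c : ℂ) ^ k * evalReal P x) (k * evalReal P x) 1 := by
    have := ((hasDerivAt_id (1 : ℝ)).ofReal_comp.pow k).mul_const (evalReal P x)
    refine this.congr_deriv ?_
    simp
  have h4 : (evalReal P ∘ fun c : ℝ => c • x) = fun c : ℝ => (c : ℂ) ^ k * evalReal P x :=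
    funext fun c => evalReal_smul hP c x
  have h5 : HasDerivAt (evalReal P ∘ fun c : ℝ => c • x)
      (fderiv ℝ (evalReal P) x ((1 : ℝ) • x)) 1 := h2
  rw [h4] at h5
  have := h5.unique h3
  rwa [one_smul] at this

theorem conj_evalReal (P : MvPolynomial (Fin d) ℂ) (x : 𝔼) :
    (starRingEnd ℂ) (evalReal P x) = evalReal (MvPolynomial.map (starRingEnd ℂ) P) x := by
  rw [evalReal, evalReal, MvPolynomial.eval_map, MvPolynomial.eval, MvPolynomial.coe_eval₂Hom,
    MvPolynomial.hom_eval₂]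
  congr 1
  ext i
  simp

theorem mem_harmonicHomogeneous {k : ℕ} {P : MvPolynomial (Fin d) ℂ} :
    P ∈ harmonicHomogeneous d k ↔ P.IsHomogeneous k ∧
      ∑ i, MvPolynomial.pderiv i (MvPolynomial.pderiv i P) = 0 := by
  simp [harmonicHomogeneous, Submodule.mem_inf, LinearMap.sum_apply]

theorem map_conj_mem_harmonicHomogeneous {k : ℕ} {P : MvPolynomial (Fin d) ℂ}
    (hP : P ∈ harmonicHomogeneous d k) :
    MvPolynomial.map (starRingEnd ℂ) P ∈ harmonicHomogeneous d k := by
  rw [mem_harmonicHomogeneous] at hP ⊢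
  refine ⟨hP.1.map _, ?_⟩
  simp only [MvPolynomial.pderiv_map]
  rw [← map_sum, hP.2, map_zero]

/-- A harmonic homogeneous polynomial is an eigenfunction of the angular Laplacian. -/
theorem sum_linDeriv_rotGen_evalReal {k : ℕ} {P : MvPolynomial (Fin d) ℂ}
    (hP : P ∈ harmonicHomogeneous d k) (x : 𝔼) :
    2⁻¹ * ∑ i, ∑ j, linDeriv (rotGen i j) (linDeriv (rotGen i j) (evalReal P)) x =
      -(k * (k + d - 2)) * evalReal P x := by
  obtain ⟨hk, hL⟩ := mem_harmonicHomogeneous.1 hP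
  -- With `ΔP = 0` and Euler's identity, the radial part is `k² + (d - 2)k` times `P`, so the
  -- angular part is its negative.
  have h := norm_sq_mul_laplacian
    (((contDiff_evalReal P).contDiffAt (x := x)).of_le (by norm_cast))
  have hE : linDeriv (.id ℝ 𝔼) (evalReal P) = fun y => (k : ℂ) * evalReal P y :=
    funext fun y => linDeriv_id_evalReal hk y
  have hEE : linDeriv (.id ℝ 𝔼) (linDeriv (.id ℝ 𝔼) (evalReal P)) x =
      k * (k * evalReal P x) := by
    have hc : linDeriv (.id ℝ 𝔼) (fun y => (k : ℂ) * evalReal P y) x =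
        k * linDeriv (.id ℝ 𝔼) (evalReal P) x := by
      rw [linDeriv, fderiv_const_mul ((contDiff_evalReal P).differentiable (by simp) x)]
      rfl
    rw [hE, hc, linDeriv_id_evalReal hk]
  rw [laplacian_evalReal, hL, hEE, linDeriv_id_evalReal hk] at h
  have h0 : evalReal (0 : MvPolynomial (Fin d) ℂ) x = 0 := by simp [evalReal]
  rw [h0, mul_zero] at h
  linear_combination -h

end Polynomial

section Radial

variable {d : ℕ}

local notation "𝔼" => EuclideanSpace ℝ (Fin d)

/-- Homogeneity moves the weight from `θ` to `rθ`, so that both factors are functions on `ℝ^d`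
evaluated at the same point and the rotation fields act on either of them. -/
theorem fourierLaplaceCoeff_mul_pow {k : ℕ} {P : MvPolynomial (Fin d) ℂ}
    (hP : P.IsHomogeneous k) (h : 𝔼 → ℂ) (r : ℝ) :
    ∫ θ : sphere (0 : 𝔼) 1, h (r • (θ : 𝔼)) *
        evalReal (MvPolynomial.map (starRingEnd ℂ) P) (r • (θ : 𝔼)) ∂(surfaceMeasure d) =
      (r : ℂ) ^ k * fourierLaplaceCoeff h P r := by
  rw [fourierLaplaceCoeff, ← integral_const_mul]
  refine integral_congr_ae (.of_forall fun θ => ?_)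
  simp only [conj_evalReal, evalReal_smul (hP.map (starRingEnd ℂ))]
  ring

/-- The radial form of the Laplacian on Fourier-Laplace coefficients. -/
theorem sq_mul_fourierLaplaceCoeff_laplacian {k : ℕ} {P : MvPolynomial (Fin d) ℂ}
    (hP : P ∈ harmonicHomogeneous d k) {G : Set 𝔼} (hG : IsOpen G) {f : 𝔼 → ℂ}
    (hf : ContDiffOn ℝ ∞ f G) {r : ℝ} (hr0 : 0 < r)
    (hr : ∀ θ : sphere (0 : 𝔼) 1, r • (θ : 𝔼) ∈ G) :
    (r : ℂ) ^ 2 * fourierLaplaceCoeff (Δ f) P r =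
      fourierLaplaceCoeff (linDeriv (.id ℝ 𝔼) (linDeriv (.id ℝ 𝔼) f)) P r +
      (d - 2) * fourierLaplaceCoeff (linDeriv (.id ℝ 𝔼) f) P r -
      k * (k + d - 2) * fourierLaplaceCoeff f P r := by
  have hPk := (mem_harmonicHomogeneous.1 hP).1
  have hrk : (r : ℂ) ^ k ≠ 0 := pow_ne_zero _ (by exact_mod_cast hr0.ne')
  set w : 𝔼 → ℂ := evalReal (MvPolynomial.map (starRingEnd ℂ) P) with hw
  have hwc : ContDiff ℝ ∞ w := contDiff_evalReal _
  have hint : ∀ {h : 𝔼 → ℂ}, ContDiffOn ℝ ∞ h G → Integrable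
      (fun θ : sphere (0 : 𝔼) 1 => h (r • (θ : 𝔼)) * w (r • (θ : 𝔼))) (surfaceMeasure d) :=
    fun hh => integrable_sphere (continuous_comp_sphere (hh.mul hwc.contDiffOn).continuousOn hr)
  have hE := ContDiffOn.linDeriv hG hf (.id ℝ 𝔼)
  have hEE := ContDiffOn.linDeriv hG hE (.id ℝ 𝔼)
  have hL : ∀ i j : Fin d, ContDiffOn ℝ ∞ (linDeriv (rotGen i j) (linDeriv (rotGen i j) f)) G :=
    fun i j => ContDiffOn.linDeriv hG (ContDiffOn.linDeriv hG hf _) _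
  have hLw : ∀ i j : Fin d, Integrable (fun θ : sphere (0 : 𝔼) 1 => f (r • (θ : 𝔼)) *
      linDeriv (rotGen i j) (linDeriv (rotGen i j) w) (r • (θ : 𝔼))) (surfaceMeasure d) :=
    fun i j => integrable_sphere (continuous_comp_sphere (hf.mul
      (ContDiffOn.linDeriv hG (ContDiffOn.linDeriv hG hwc.contDiffOn _) _)).continuousOn hr)
  -- The angular operator is moved from `f` to `w`, which is again harmonic and homogeneous of
  -- degree `k` and thus an eigenfunction.
  have hang : 2⁻¹ * ∑ i, ∑ j, ∫ θ : sphere (0 : 𝔼) 1,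
      linDeriv (rotGen i j) (linDeriv (rotGen i j) f) (r • (θ : 𝔼)) * w (r • (θ : 𝔼))
        ∂(surfaceMeasure d) =
      -(k * (k + d - 2)) * ∫ θ : sphere (0 : 𝔼) 1, f (r • (θ : 𝔼)) * w (r • (θ : 𝔼))
        ∂(surfaceMeasure d) := by
    simp only [integral_linDeriv_linDeriv_mul hG hf hwc hr (rotGen_mem_skewAdjoint _ _)]
    rw [← integral_const_mul]
    have hs : ∀ i : Fin d, ∑ j, ∫ θ : sphere (0 : 𝔼) 1, f (r • (θ : 𝔼)) *
        linDeriv (rotGen i j) (linDeriv (rotGen i j) w) (r • (θ : 𝔼)) ∂(surfaceMeasure d) =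
        ∫ θ : sphere (0 : 𝔼) 1, ∑ j, f (r • (θ : 𝔼)) *
        linDeriv (rotGen i j) (linDeriv (rotGen i j) w) (r • (θ : 𝔼)) ∂(surfaceMeasure d) :=
      fun i => (integral_finsetSum _ fun j _ => hLw i j).symm
    simp only [hs]
    rw [← integral_finsetSum _ fun i _ => integrable_finsetSum _ fun j _ => hLw i j,
      ← integral_const_mul]
    refine integral_congr_ae (.of_forall fun θ => ?_)
    have h := sum_linDeriv_rotGen_evalReal (map_conj_mem_harmonicHomogeneous hP) (r • (θ : 𝔼))
    simp only [← Finset.mul_sum]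
    rw [mul_left_comm, h]
    ring
  have hmain : (r : ℂ) ^ 2 * ∫ θ : sphere (0 : 𝔼) 1, Δ f (r • (θ : 𝔼)) * w (r • (θ : 𝔼))
        ∂(surfaceMeasure d) =
      (∫ θ : sphere (0 : 𝔼) 1, linDeriv (.id ℝ 𝔼) (linDeriv (.id ℝ 𝔼) f) (r • (θ : 𝔼)) *
        w (r • (θ : 𝔼)) ∂(surfaceMeasure d)) +
      (d - 2) * (∫ θ : sphere (0 : 𝔼) 1, linDeriv (.id ℝ 𝔼) f (r • (θ : 𝔼)) *
        w (r • (θ : 𝔼)) ∂(surfaceMeasure d)) +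
      2⁻¹ * ∑ i, ∑ j, ∫ θ : sphere (0 : 𝔼) 1,
      linDeriv (rotGen i j) (linDeriv (rotGen i j) f) (r • (θ : 𝔼)) * w (r • (θ : 𝔼))
        ∂(surfaceMeasure d) := by
    have hs : ∀ i : Fin d, ∑ j, ∫ θ : sphere (0 : 𝔼) 1,
        linDeriv (rotGen i j) (linDeriv (rotGen i j) f) (r • (θ : 𝔼)) * w (r • (θ : 𝔼))
          ∂(surfaceMeasure d) =
        ∫ θ : sphere (0 : 𝔼) 1, ∑ j,
        linDeriv (rotGen i j) (linDeriv (rotGen i j) f) (r • (θ : 𝔼)) * w (r • (θ : 𝔼))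
          ∂(surfaceMeasure d) :=
      fun i => (integral_finsetSum _ fun j _ => hint (hL i j)).symm
    simp only [hs]
    rw [← integral_finsetSum _ fun i _ => integrable_finsetSum _ fun j _ => hint (hL i j),
      ← integral_const_mul, ← integral_const_mul, ← integral_const_mul,
      ← integral_add (hint hEE) ((hint hE).const_mul _)]
    have hadd := integral_add ((hint hEE).add ((hint hE).const_mul (d - 2 : ℂ)))
      ((integrable_finsetSum Finset.univ fun i _ =>
          integrable_finsetSum Finset.univ fun j _ => hint (hL i j)).const_mul (2⁻¹ : ℂ))
    refine Eq.trans ?_ hadd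
    refine integral_congr_ae (.of_forall fun θ => ?_)
    have h := norm_sq_mul_laplacian
      ((hf.contDiffAt (hG.mem_nhds (hr θ))).of_le (m := 2) (by norm_cast))
    have hn : ‖r • (θ : 𝔼)‖ = r := by
      rw [norm_smul, norm_eq_of_mem_sphere, mul_one, Real.norm_of_nonneg hr0.le]
    rw [hn] at h
    push_cast at h
    simp only [← Finset.sum_mul, Pi.add_apply]
    linear_combination w (r • (θ : 𝔼)) * h
  rw [hang, fourierLaplaceCoeff_mul_pow hPk, fourierLaplaceCoeff_mul_pow hPk,
    fourierLaplaceCoeff_mul_pow hPk, fourierLaplaceCoeff_mul_pow hPk] at hmain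
  apply mul_left_cancel₀ hrk
  linear_combination hmain

end Radial

end Polyharmonic

/-! ### Generalized derivatives of the coefficients and an interior estimate. -/

namespace Polyharmonic

open MeasureTheory Metric

section Annulus

variable {d : ℕ}

local notation "𝔼" => EuclideanSpace ℝ (Fin d)

theorem isOpen_annularRegion (d : ℕ) (r₀ : ℝ≥0) (r₁ : ℝ≥0∞) : IsOpen (annularRegion d r₀ r₁) :=
  (isOpen_lt continuous_const continuous_enorm).inter (isOpen_lt continuous_enorm continuous_const)

/-- The logarithms of the radii of the annular region. -/
def logRadii (r₀ : ℝ≥0) (r₁ : ℝ≥0∞) : Set ℝ :=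
  {v | (r₀ : ℝ) < Real.exp v ∧ ENNReal.ofReal (Real.exp v) < r₁}

theorem isOpen_logRadii (r₀ : ℝ≥0) (r₁ : ℝ≥0∞) : IsOpen (logRadii r₀ r₁) :=
  (isOpen_lt continuous_const Real.continuous_exp).inter
    (isOpen_lt (ENNReal.continuous_ofReal.comp Real.continuous_exp) continuous_const)

theorem ordConnected_logRadii (r₀ : ℝ≥0) (r₁ : ℝ≥0∞) : (logRadii r₀ r₁).OrdConnected :=
  ⟨fun _ ha _ hb _ ht => ⟨ha.1.trans_le (Real.exp_le_exp.2 ht.1),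
    (ENNReal.ofReal_le_ofReal (Real.exp_le_exp.2 ht.2)).trans_lt hb.2⟩⟩

theorem mem_annularRegion_iff {r₀ : ℝ≥0} {r₁ : ℝ≥0∞} {x : 𝔼} :
    x ∈ annularRegion d r₀ r₁ ↔ (r₀ : ℝ) < ‖x‖ ∧ ENNReal.ofReal ‖x‖ < r₁ := by
  rw [annularRegion, Set.mem_ofPred_eq, ofReal_norm]
  refine and_congr_left fun _ => ?_
  rw [← ofReal_norm, ← ENNReal.ofReal_coe_nnreal]
  constructor
  · intro h; exact (ENNReal.ofReal_lt_ofReal_iff_of_nonneg r₀.2).1 h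
  · intro h; exact (ENNReal.ofReal_lt_ofReal_iff_of_nonneg r₀.2).2 h

theorem norm_exp_smul_sphere (v : ℝ) (θ : sphere (0 : 𝔼) 1) :
    ‖Real.exp v • (θ : 𝔼)‖ = Real.exp v := by
  rw [norm_smul, norm_eq_of_mem_sphere, mul_one, Real.norm_of_nonneg (Real.exp_pos v).le]

theorem exp_smul_mem_annularRegion {r₀ : ℝ≥0} {r₁ : ℝ≥0∞} {v : ℝ} (hv : v ∈ logRadii r₀ r₁)
    (θ : sphere (0 : 𝔼) 1) : Real.exp v • (θ : 𝔼) ∈ annularRegion d r₀ r₁ := by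
  rw [mem_annularRegion_iff, norm_exp_smul_sphere]
  exact hv

/-- Differentiation of a Fourier-Laplace coefficient in the logarithmic radial variable. -/
theorem hasDerivAt_fourierLaplaceCoeff_exp {r₀ : ℝ≥0} {r₁ : ℝ≥0∞} {h : 𝔼 → ℂ}
    (hh : ContDiffOn ℝ ∞ h (annularRegion d r₀ r₁)) (P : MvPolynomial (Fin d) ℂ) {v : ℝ}
    (hv : v ∈ logRadii r₀ r₁) :
    HasDerivAt (fun v => fourierLaplaceCoeff h P (Real.exp v))
      (fourierLaplaceCoeff (linDeriv (.id ℝ 𝔼) h) P (Real.exp v)) v := by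
  have hG := isOpen_annularRegion d r₀ r₁
  have hP : Continuous fun θ : sphere (0 : 𝔼) 1 => (starRingEnd ℂ) (evalReal P θ) :=
    Complex.continuous_conj.comp
      ((contDiff_evalReal P).continuous.comp continuous_subtype_val)
  refine hasDerivAt_integral_of_continuousOn (μ := surfaceMeasure d) (isOpen_logRadii r₀ r₁)
    (F := fun v (θ : sphere (0 : 𝔼) 1) => h (Real.exp v • (θ : 𝔼)) *
      (starRingEnd ℂ) (evalReal P θ))
    (F' := fun v (θ : sphere (0 : 𝔼) 1) => linDeriv (.id ℝ 𝔼) h (Real.exp v • (θ : 𝔼)) *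
      (starRingEnd ℂ) (evalReal P θ)) (fun t ht => ?_) ?_ (fun t ht θ => ?_) hv
  · exact (continuous_comp_sphere hh.continuousOn (exp_smul_mem_annularRegion ht)).mul hP
  · refine ContinuousOn.mul ?_ (hP.comp continuous_snd).continuousOn
    refine (ContDiffOn.linDeriv hG hh _).continuousOn.comp
      (f := fun p : ℝ × sphere (0 : 𝔼) 1 => Real.exp p.1 • (p.2 : 𝔼)) ?_
      fun p hp => exp_smul_mem_annularRegion hp.1 p.2
    exact ((Real.continuous_exp.comp continuous_fst).smul
      (continuous_subtype_val.comp continuous_snd)).continuousOn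
  · have hd : HasFDerivAt h (fderiv ℝ h (Real.exp t • (θ : 𝔼))) (Real.exp t • (θ : 𝔼)) :=
      ((hh.differentiableOn (by simp)).differentiableAt
        (hG.mem_nhds (exp_smul_mem_annularRegion ht θ))).hasFDerivAt
    exact (hd.comp_hasDerivAt t ((Real.hasDerivAt_exp t).smul_const (θ : 𝔼))).mul_const _

theorem contDiffOn_iterate_laplacian {G : Set 𝔼} (hG : IsOpen G) {f : 𝔼 → ℂ}
    (hf : ContDiffOn ℝ ∞ f G) (p : ℕ) : ContDiffOn ℝ ∞ (Laplacian.laplacian^[p] f) G := by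
  induction p with
  | zero => exact hf
  | succ p ih => rw [Function.iterate_succ_apply']; exact ContDiffOn.laplacian hG ih

theorem hasDerivAt_cexp_two_mul (p : ℕ) (v : ℝ) :
    HasDerivAt (fun v : ℝ => Complex.exp (2 * p * v))
      (2 * p * Complex.exp (2 * p * v)) v := by
  have h := ((hasDerivAt_id v).ofReal_comp.const_mul (2 * p : ℂ)).cexp
  simpa [mul_comm] using h

theorem genDeriv_succ_apply (d k n : ℕ) (g : ℝ → ℂ) (v : ℝ) :
    genDeriv d k (n + 1) g v =
      deriv (genDeriv d k n g) v - exponent d k n * genDeriv d k n g v := rfl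

/-- `(d/dv - k)` applied to a Fourier-Laplace coefficient. -/
noncomputable def firstOrderCoeff (k : ℕ) (h : 𝔼 → ℂ) (P : MvPolynomial (Fin d) ℂ) (v : ℝ) : ℂ :=
  fourierLaplaceCoeff (linDeriv (.id ℝ 𝔼) h) P (Real.exp v) -
    k * fourierLaplaceCoeff h P (Real.exp v)

/-- The radial equation in factorized form: `(d/dv + k + d - 2)(d/dv - k)` applied to the
coefficient of `h` is `e^{2v}` times the coefficient of `Δh`. -/
theorem hasDerivAt_firstOrderCoeff {k : ℕ} {P : MvPolynomial (Fin d) ℂ}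
    (hP : P ∈ harmonicHomogeneous d k) {r₀ : ℝ≥0} {r₁ : ℝ≥0∞} {h : 𝔼 → ℂ}
    (hh : ContDiffOn ℝ ∞ h (annularRegion d r₀ r₁)) {v : ℝ} (hv : v ∈ logRadii r₀ r₁) :
    HasDerivAt (firstOrderCoeff k h P)
      (Complex.exp (2 * v) * fourierLaplaceCoeff (Δ h) P (Real.exp v) -
        (k + d - 2) * firstOrderCoeff k h P v) v := by
  have hG := isOpen_annularRegion d r₀ r₁
  have h1 := hasDerivAt_fourierLaplaceCoeff_exp hh P hv
  have h2 := hasDerivAt_fourierLaplaceCoeff_exp (ContDiffOn.linDeriv hG hh (.id ℝ 𝔼)) P hv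
  have h3 := sq_mul_fourierLaplaceCoeff_laplacian hP hG hh (Real.exp_pos v)
    (exp_smul_mem_annularRegion hv)
  have h4 : Complex.exp (2 * v) = (Real.exp v : ℂ) ^ 2 := by
    rw [Complex.ofReal_exp, ← Complex.exp_nat_mul]; norm_num
  refine (h2.sub (h1.const_mul (k : ℂ))).congr_deriv ?_
  rw [h4, h3, firstOrderCoeff]
  ring

/-- Differentiating `e^{2pv}` yields `2p`, which absorbs the shift in `λ_{2p} = k + 2p` and
`λ_{2p+1} = -(k + d - 2) + 2p`. Each pair of steps is therefore the factorized radial operator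
applied to the coefficient of `Δ^p f`. -/
theorem genDeriv_fourierLaplaceCoeff {k : ℕ} {P : MvPolynomial (Fin d) ℂ}
    (hP : P ∈ harmonicHomogeneous d k) {r₀ : ℝ≥0} {r₁ : ℝ≥0∞} {f : 𝔼 → ℂ}
    (hf : ContDiffOn ℝ ∞ f (annularRegion d r₀ r₁)) (p : ℕ) :
    (∀ v ∈ logRadii r₀ r₁, genDeriv d k (2 * p) (fun v => fourierLaplaceCoeff f P (Real.exp v)) v =
      Complex.exp (2 * p * v) *
        fourierLaplaceCoeff (Laplacian.laplacian^[p] f) P (Real.exp v)) ∧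
    (∀ v ∈ logRadii r₀ r₁,
      genDeriv d k (2 * p + 1) (fun v => fourierLaplaceCoeff f P (Real.exp v)) v =
      Complex.exp (2 * p * v) * firstOrderCoeff k (Laplacian.laplacian^[p] f) P v) := by
  have hG := isOpen_annularRegion d r₀ r₁
  have hU := isOpen_logRadii r₀ r₁
  have hodd : ∀ p : ℕ, (∀ v ∈ logRadii r₀ r₁,
      genDeriv d k (2 * p) (fun v => fourierLaplaceCoeff f P (Real.exp v)) v =
      Complex.exp (2 * p * v) *
        fourierLaplaceCoeff (Laplacian.laplacian^[p] f) P (Real.exp v)) →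
      (∀ v ∈ logRadii r₀ r₁,
      genDeriv d k (2 * p + 1) (fun v => fourierLaplaceCoeff f P (Real.exp v)) v =
      Complex.exp (2 * p * v) * firstOrderCoeff k (Laplacian.laplacian^[p] f) P v) := by
    intro p he v hv
    have h1 := (hasDerivAt_cexp_two_mul p v).mul
      (hasDerivAt_fourierLaplaceCoeff_exp (contDiffOn_iterate_laplacian hG hf p) P hv)
    have h2 := h1.congr_of_eventuallyEq (Filter.eventually_of_mem (hU.mem_nhds hv) he)
    rw [genDeriv_succ_apply, h2.deriv, he v hv, exponent_even, firstOrderCoeff]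
    push_cast
    ring
  induction p with
  | zero =>
    have h0 : ∀ v ∈ logRadii r₀ r₁,
        genDeriv d k (2 * 0) (fun v => fourierLaplaceCoeff f P (Real.exp v)) v =
        Complex.exp (2 * (0 : ℕ) * v) *
        fourierLaplaceCoeff (Laplacian.laplacian^[0] f) P (Real.exp v) := by
      intro v _; simp [genDeriv]
    exact ⟨h0, hodd 0 h0⟩
  | succ p ih =>
    suffices h0 : ∀ v ∈ logRadii r₀ r₁,
        genDeriv d k (2 * (p + 1)) (fun v => fourierLaplaceCoeff f P (Real.exp v)) v =
        Complex.exp (2 * (p + 1 : ℕ) * v) *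
        fourierLaplaceCoeff (Laplacian.laplacian^[p + 1] f) P (Real.exp v) from ⟨h0, hodd _ h0⟩
    intro v hv
    have h1 := (hasDerivAt_cexp_two_mul p v).mul
      (hasDerivAt_firstOrderCoeff hP (contDiffOn_iterate_laplacian hG hf p) hv)
    have h2 := h1.congr_of_eventuallyEq (Filter.eventually_of_mem (hU.mem_nhds hv) ih.2)
    have h3 : Complex.exp (2 * (p + 1 : ℕ) * v) =
        Complex.exp (2 * p * v) * Complex.exp (2 * v) := by
      rw [← Complex.exp_add]; push_cast; ring_nf
    rw [show 2 * (p + 1) = 2 * p + 1 + 1 by ring, genDeriv_succ_apply, h2.deriv, ih.2 v hv,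
      exponent_odd, Function.iterate_succ_apply', h3]
    push_cast
    ring

theorem differentiableAt_genDeriv {k : ℕ} {P : MvPolynomial (Fin d) ℂ}
    (hP : P ∈ harmonicHomogeneous d k) {r₀ : ℝ≥0} {r₁ : ℝ≥0∞} {f : 𝔼 → ℂ}
    (hf : ContDiffOn ℝ ∞ f (annularRegion d r₀ r₁)) (n : ℕ) {v : ℝ} (hv : v ∈ logRadii r₀ r₁) :
    DifferentiableAt ℝ
      (genDeriv d k n (fun v => fourierLaplaceCoeff f P (Real.exp v))) v := by
  have hG := isOpen_annularRegion d r₀ r₁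
  have hU := (isOpen_logRadii r₀ r₁).mem_nhds hv
  obtain ⟨p, rfl | rfl⟩ := Nat.even_or_odd' n
  · exact (((hasDerivAt_cexp_two_mul p v).mul (hasDerivAt_fourierLaplaceCoeff_exp
      (contDiffOn_iterate_laplacian hG hf p) P hv)).congr_of_eventuallyEq
      (Filter.eventually_of_mem hU (genDeriv_fourierLaplaceCoeff hP hf p).1)).differentiableAt
  · exact (((hasDerivAt_cexp_two_mul p v).mul (hasDerivAt_firstOrderCoeff hP
      (contDiffOn_iterate_laplacian hG hf p) hv)).congr_of_eventuallyEq
      (Filter.eventually_of_mem hU (genDeriv_fourierLaplaceCoeff hP hf p).2)).differentiableAt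

theorem isCompact_shell (a b : ℝ) :
    IsCompact {x : 𝔼 | Real.exp a ≤ ‖x‖ ∧ ‖x‖ ≤ Real.exp b} := by
  refine (isCompact_closedBall (0 : 𝔼) (Real.exp b)).of_isClosed_subset
    ((isClosed_le continuous_const continuous_norm).inter
      (isClosed_le continuous_norm continuous_const)) fun x hx => ?_
  simpa using hx.2

/-- Fourier-Laplace coefficients of iterated Laplacians inherit the growth bound. -/
theorem exists_fourierLaplaceCoeff_bound (P : MvPolynomial (Fin d) ℂ) {r₀ : ℝ≥0} {r₁ : ℝ≥0∞}
    {τ : ℝ≥0} {f : 𝔼 → ℂ} (hf : IsPolyharmonicInfiniteOrder f τ (annularRegion d r₀ r₁))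
    {a b : ℝ} (hab : Set.Icc a b ⊆ logRadii r₀ r₁) {σ : ℝ} (hσ : τ < σ) :
    ∃ C : ℝ, 0 ≤ C ∧ ∀ p : ℕ, ∀ t ∈ Set.Icc a b,
      ‖fourierLaplaceCoeff (Laplacian.laplacian^[p] f) P (Real.exp t)‖ ≤
        C * (2 * p)! * σ ^ (2 * p) := by
  obtain ⟨C, hC, hb⟩ := hf.2 {x : 𝔼 | Real.exp a ≤ ‖x‖ ∧ ‖x‖ ≤ Real.exp b} (fun x hx => by
      have hx0 : 0 < ‖x‖ := (Real.exp_pos a).trans_le hx.1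
      have := hab ⟨(Real.le_log_iff_exp_le hx0).2 hx.1, (Real.log_le_iff_le_exp hx0).2 hx.2⟩
      rw [logRadii, Set.mem_ofPred_eq, Real.exp_log hx0] at this
      exact mem_annularRegion_iff.2 this) (isCompact_shell a b) (σ - τ) (sub_pos.2 hσ)
  rw [add_sub_cancel] at hb
  have hint : Integrable (fun θ : sphere (0 : 𝔼) 1 => ‖evalReal P θ‖) (surfaceMeasure d) :=
    (integrable_sphere ((contDiff_evalReal P).continuous.comp continuous_subtype_val)).norm
  refine ⟨C * ∫ θ : sphere (0 : 𝔼) 1, ‖evalReal P θ‖ ∂(surfaceMeasure d),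
    mul_nonneg hC.le (integral_nonneg fun _ => norm_nonneg _), fun p t ht => ?_⟩
  calc _ ≤ ∫ θ : sphere (0 : 𝔼) 1, (C * (2 * p)! * σ ^ (2 * p)) * ‖evalReal P θ‖
        ∂(surfaceMeasure d) := by
        refine norm_integral_le_of_norm_le (hint.const_mul _) (.of_forall fun θ => ?_)
        rw [norm_mul, RCLike.norm_conj]
        refine mul_le_mul_of_nonneg_right (hb p _ ?_) (norm_nonneg _)
        rw [Set.mem_ofPred_eq, norm_exp_smul_sphere]
        exact ⟨Real.exp_le_exp.2 ht.1, Real.exp_le_exp.2 ht.2⟩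
    _ = _ := by rw [integral_const_mul]; ring

end Annulus

/-- Interior estimate for the intermediate function of a factorized second order equation. -/
theorem exists_norm_le_of_factorized_ode {a b : ℝ} (hab : a < b) {κ c : ℝ} (hM : 0 < κ + c)
    {s : ℝ} (hs : s ∈ Set.Icc a b) :
    ∃ K : ℝ, 0 ≤ K ∧ ∀ (F w H : ℝ → ℂ),
      (∀ t ∈ Set.Icc a b, HasDerivAt F (w t + κ * F t) t) →
      (∀ t ∈ Set.Icc a b, HasDerivAt w (H t - c * w t) t) →
      ∀ A B : ℝ, (∀ t ∈ Set.Icc a b, ‖F t‖ ≤ A) → (∀ t ∈ Set.Icc a b, ‖H t‖ ≤ B) →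
      ‖w s‖ ≤ K * (A + B) := by
  obtain ⟨Q, hQ⟩ : ∃ Q : ℝ, ∀ t ∈ Set.Icc a b,
      Real.exp (c * t) ≤ Q ∧ Real.exp (-κ * t) ≤ Q ∧ Real.exp (-(κ + c) * t) ≤ Q := by
    obtain ⟨Q, hQ⟩ := (isCompact_Icc (a := a) (b := b)).exists_bound_of_continuousOn
      (f := fun t : ℝ => Real.exp (c * t) + Real.exp (-κ * t) + Real.exp (-(κ + c) * t))
      (by fun_prop)
    refine ⟨Q, fun t ht => ?_⟩
    have h := (le_abs_self _).trans (hQ t ht)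
    have h1 := Real.exp_pos (c * t)
    have h2 := Real.exp_pos (-κ * t)
    have h3 := Real.exp_pos (-(κ + c) * t)
    exact ⟨by linarith, by linarith, by linarith⟩
  have hQ0 : 0 ≤ Q := (Real.exp_pos _).le.trans (hQ s hs).1
  -- The integral of `e^{-(κ+c)t}` over `[a, b]`.
  set δ : ℝ := (Real.exp (-(κ + c) * a) - Real.exp (-(κ + c) * b)) / (κ + c) with hδ
  have hδ0 : 0 < δ := div_pos (sub_pos.2 (Real.exp_lt_exp.2 (by nlinarith))) hM
  set L := b - a with hL
  have hL0 : 0 < L := sub_pos.2 hab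
  refine ⟨Real.exp (-c * s) / δ * (Q ^ 2 * L ^ 2 + 2 * Q), by positivity,
    fun F w H hF hw A B hA hB => ?_⟩
  have haI : a ∈ Set.Icc a b := Set.left_mem_Icc.2 hab.le
  have hbI : b ∈ Set.Icc a b := Set.right_mem_Icc.2 hab.le
  have hA0 : 0 ≤ A := (norm_nonneg _).trans (hA a haI)
  have hB0 : 0 ≤ B := (norm_nonneg _).trans (hB a haI)
  have hexp : ∀ m t : ℝ, HasDerivAt (fun t : ℝ => (Real.exp (m * t) : ℂ))
      (m * Real.exp (m * t)) t := by
    intro m t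
    have h := (((hasDerivAt_id t).const_mul m).exp).ofReal_comp
    refine h.congr_deriv ?_
    simp [mul_comm]
  have hnexp : ∀ x : ℝ, ‖(Real.exp x : ℂ)‖ = Real.exp x := fun x => by
    rw [Complex.norm_real, Real.norm_of_nonneg (Real.exp_pos x).le]
  -- The integrating factor gives `W' = e^{ct} H`, so `W` deviates from `W s` by at most a multiple
  -- of `B`.
  set W : ℝ → ℂ := fun t => (Real.exp (c * t) : ℂ) * w t with hW
  have hWd : ∀ t ∈ Set.Icc a b, HasDerivAt W (Real.exp (c * t) * H t) t := fun t ht => by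
    refine ((hexp c t).mul (hw t ht)).congr_deriv ?_
    ring
  have hWs : ∀ t ∈ Set.Icc a b, ‖W t - W s‖ ≤ Q * B * L := by
    intro t ht
    have h := (convex_Icc a b).norm_image_sub_le_of_norm_hasDerivWithin_le (C := Q * B)
      (fun t ht => (hWd t ht).hasDerivWithinAt) (fun t ht => by
        rw [norm_mul, hnexp]
        exact mul_le_mul (hQ t ht).1 (hB t ht) (norm_nonneg _) hQ0) hs ht
    refine h.trans (mul_le_mul_of_nonneg_left ?_ (mul_nonneg hQ0 hB0))
    rw [Real.norm_eq_abs, abs_le]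
    constructor <;> linarith [hs.1, hs.2, ht.1, ht.2]
  set E : ℝ → ℂ := fun t => -((Real.exp (-(κ + c) * t) : ℂ) / ((κ + c : ℝ) : ℂ)) with hE
  have hMc : ((κ + c : ℝ) : ℂ) ≠ 0 := by exact_mod_cast hM.ne'
  have hEd : ∀ t, HasDerivAt E (Real.exp (-(κ + c) * t)) t := fun t => by
    refine ((hexp (-(κ + c)) t).div_const _).neg.congr_deriv ?_
    rw [Complex.ofReal_neg, neg_mul, neg_div, neg_neg, mul_div_assoc, mul_div_cancel₀ _ hMc]
  -- Since `(e^{-κt} F)' = e^{-(κ+c)t} W`, subtracting `W s` times a primitive of `e^{-(κ+c)t}`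
  -- leaves a function with small derivative. Comparing the ends of `[a, b]` isolates `W s * δ`.
  set G : ℝ → ℂ := fun t => (Real.exp (-κ * t) : ℂ) * F t - W s * E t with hGdef
  have hGd : ∀ t ∈ Set.Icc a b, HasDerivAt G (Real.exp (-(κ + c) * t) * (W t - W s)) t := by
    intro t ht
    refine (((hexp (-κ) t).mul (hF t ht)).sub ((hEd t).const_mul (W s))).congr_deriv ?_
    have : (Real.exp (-κ * t) : ℂ) = Real.exp (-(κ + c) * t) * Real.exp (c * t) := by
      rw [← Complex.ofReal_mul, ← Real.exp_add]; ring_nf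
    simp only [hW]
    rw [this]
    push_cast
    ring
  have hGab : ‖G b - G a‖ ≤ Q * (Q * B * L) * L := by
    have h := (convex_Icc a b).norm_image_sub_le_of_norm_hasDerivWithin_le
      (C := Q * (Q * B * L)) (fun t ht => (hGd t ht).hasDerivWithinAt) (fun t ht => by
        rw [norm_mul, hnexp]
        exact mul_le_mul (hQ t ht).2.2 (hWs t ht) (norm_nonneg _) hQ0) haI hbI
    rwa [Real.norm_of_nonneg hL0.le] at h
  have hEab : E b - E a = (δ : ℂ) := by
    simp only [hE, hδ]
    push_cast
    ring
  have hWsδ : ‖W s‖ * δ ≤ Q * (Q * B * L) * L + Q * A + Q * A := by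
    have h : W s * (δ : ℂ) = (Real.exp (-κ * b) : ℂ) * F b - (Real.exp (-κ * a) : ℂ) * F a -
        (G b - G a) := by
      rw [← hEab]; simp only [hGdef]; ring
    have h2 : ∀ t ∈ Set.Icc a b, ‖(Real.exp (-κ * t) : ℂ) * F t‖ ≤ Q * A := fun t ht => by
      rw [norm_mul, hnexp]
      exact mul_le_mul (hQ t ht).2.1 (hA t ht) (norm_nonneg _) hQ0
    have h3 : ‖W s‖ * δ = ‖W s * (δ : ℂ)‖ := by
      rw [norm_mul (W s), Complex.norm_real δ, Real.norm_of_nonneg hδ0.le]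
    rw [h3, h]
    have := (norm_sub_le ((Real.exp (-κ * b) : ℂ) * F b - (Real.exp (-κ * a) : ℂ) * F a)
      (G b - G a)).trans (add_le_add (norm_sub_le _ _) hGab)
    linarith [h2 a haI, h2 b hbI]
  have hws : ‖w s‖ = Real.exp (-c * s) * ‖W s‖ := by
    simp only [hW]
    rw [norm_mul, hnexp, ← mul_assoc, ← Real.exp_add]
    simp
  have hWs' : ‖W s‖ ≤ (Q * (Q * B * L) * L + Q * A + Q * A) / δ := (le_div_iff₀ hδ0).2 hWsδ
  rw [hws]
  calc _ ≤ Real.exp (-c * s) * ((Q * (Q * B * L) * L + Q * A + Q * A) / δ) := by gcongr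
    _ = Real.exp (-c * s) / δ * (Q ^ 2 * L ^ 2 * B + 2 * Q * A) := by ring
    _ ≤ Real.exp (-c * s) / δ * ((Q ^ 2 * L ^ 2 + 2 * Q) * (A + B)) := by
      refine mul_le_mul_of_nonneg_left ?_ (by positivity)
      have h1 : 0 ≤ Q ^ 2 * L ^ 2 * A := by positivity
      have h2 : 0 ≤ 2 * Q * B := by positivity
      linarith
    _ = _ := by ring

end Polyharmonic

/-! ### Growth of the generalized derivatives, convergence and vanishing of the remainder. -/

namespace Polyharmonic

open MeasureTheory Metric

section Growth

variable {d : ℕ}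

local notation "𝔼" => EuclideanSpace ℝ (Fin d)

theorem norm_cexp_two_mul (p : ℕ) (v : ℝ) :
    ‖Complex.exp (2 * p * v)‖ = Real.exp v ^ (2 * p) := by
  have h : (2 * p * v : ℂ) = (2 * p : ℕ) * v := by push_cast; ring
  rw [h, Complex.exp_nat_mul, norm_pow, ← Complex.ofReal_exp, Complex.norm_real,
    Real.norm_of_nonneg (Real.exp_pos v).le]

/-- Needed on a whole interval to control the remainder. Even orders suffice there, because the
Taylor sums are taken only up to odd `N`, where the remainder contains `D^{(N+1)}`. -/
theorem exists_genDeriv_even_bound {k : ℕ} {P : MvPolynomial (Fin d) ℂ}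
    (hP : P ∈ harmonicHomogeneous d k) {r₀ : ℝ≥0} {r₁ : ℝ≥0∞} {τ : ℝ≥0} {f : 𝔼 → ℂ}
    (hf : IsPolyharmonicInfiniteOrder f τ (annularRegion d r₀ r₁))
    {a b : ℝ} (hab : Set.Icc a b ⊆ logRadii r₀ r₁) {σ : ℝ} (hσ : τ < σ) :
    ∃ C : ℝ, 0 ≤ C ∧ ∀ p : ℕ, ∀ t ∈ Set.Icc a b,
      ‖genDeriv d k (2 * p) (fun v => fourierLaplaceCoeff f P (Real.exp v)) t‖ ≤
        C * (2 * p)! * (σ * Real.exp t) ^ (2 * p) := by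
  obtain ⟨C, hC, hb⟩ := exists_fourierLaplaceCoeff_bound P hf hab hσ
  refine ⟨C, hC, fun p t ht => ?_⟩
  rw [(genDeriv_fourierLaplaceCoeff hP hf.1 p).1 t (hab ht), norm_mul, norm_cexp_two_mul]
  calc _ ≤ Real.exp t ^ (2 * p) * (C * (2 * p)! * σ ^ (2 * p)) := by
        gcongr; exact hb p t ht
    _ = _ := by rw [mul_pow]; ring

/-- Growth of the generalized derivatives `D^{(n)}` at a point, including odd orders. -/
theorem exists_genDeriv_bound {k : ℕ} {P : MvPolynomial (Fin d) ℂ}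
    (hP : P ∈ harmonicHomogeneous d k) {r₀ : ℝ≥0} {r₁ : ℝ≥0∞} {τ : ℝ≥0} {f : 𝔼 → ℂ}
    (hf : IsPolyharmonicInfiniteOrder f τ (annularRegion d r₀ r₁)) {v₀ : ℝ}
    (hv₀ : v₀ ∈ logRadii r₀ r₁) (hdk : 2 < d + 2 * k) {σ : ℝ} (hσ : τ < σ) :
    ∃ C : ℝ, 0 ≤ C ∧ ∀ n : ℕ,
      ‖genDeriv d k n (fun v => fourierLaplaceCoeff f P (Real.exp v)) v₀‖ ≤
        C * (n + 2)! * (σ * Real.exp v₀) ^ n := by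
  have hσ0 : 0 < σ := τ.2.trans_lt hσ
  have hG := isOpen_annularRegion d r₀ r₁
  obtain ⟨ε, hε, hεU⟩ := nhds_basis_closedBall.mem_iff.1 ((isOpen_logRadii r₀ r₁).mem_nhds hv₀)
  rw [Real.closedBall_eq_Icc] at hεU
  set a := v₀ - ε
  set b := v₀ + ε
  have hv₀I : v₀ ∈ Set.Icc a b := ⟨by simp [a, hε.le], by simp [b, hε.le]⟩
  obtain ⟨C, hC, hb⟩ := exists_fourierLaplaceCoeff_bound P hf hεU hσ
  have hM : (0 : ℝ) < (k : ℝ) + ((k : ℝ) + d - 2) := by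
    have : (2 : ℝ) < d + 2 * k := by exact_mod_cast hdk
    linarith
  obtain ⟨K, hK, hw⟩ := exists_norm_le_of_factorized_ode
    (show a < b by simp only [a, b]; linarith) hM hv₀I
  have hρ := Real.exp_pos v₀
  -- The interior estimate with `κ = k` and `c = k + d - 2` bounds order `2p + 1` by the
  -- coefficients of `Δ^p f` and `e^{2t} Δ^{p+1} f`. The second brings `e^{2b} σ²` and `(2p + 2)!`,
  -- hence the loss to `(n + 2)!`; the division supplies the odd power of `σ e^{v₀}`.
  set C' : ℝ := K * (C * (1 + Real.exp (2 * b) * σ ^ 2)) / (σ * Real.exp v₀) with hC'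
  have hC'0 : 0 ≤ C' := by positivity
  refine ⟨C + C', by positivity, fun n => ?_⟩
  obtain ⟨p, rfl | rfl⟩ := Nat.even_or_odd' n
  · rw [(genDeriv_fourierLaplaceCoeff hP hf.1 p).1 v₀ hv₀, norm_mul, norm_cexp_two_mul]
    have hfac : ((2 * p)! : ℝ) ≤ (2 * p + 2)! := by
      exact_mod_cast Nat.factorial_le (by omega)
    calc _ ≤ Real.exp v₀ ^ (2 * p) * (C * (2 * p)! * σ ^ (2 * p)) := by
          gcongr; exact hb p v₀ hv₀I
      _ = C * (2 * p)! * (σ * Real.exp v₀) ^ (2 * p) := by rw [mul_pow]; ring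
      _ ≤ (C + C') * (2 * p + 2)! * (σ * Real.exp v₀) ^ (2 * p) := by
          gcongr; linarith
  · rw [(genDeriv_fourierLaplaceCoeff hP hf.1 p).2 v₀ hv₀, norm_mul, norm_cexp_two_mul]
    have hfp := contDiffOn_iterate_laplacian hG hf.1 p
    have h := hw (fun v => fourierLaplaceCoeff (Laplacian.laplacian^[p] f) P (Real.exp v))
      (firstOrderCoeff k (Laplacian.laplacian^[p] f) P)
      (fun v => Complex.exp (2 * v) *
        fourierLaplaceCoeff (Δ (Laplacian.laplacian^[p] f)) P (Real.exp v))
      (fun t ht => (hasDerivAt_fourierLaplaceCoeff_exp hfp P (hεU ht)).congr_deriv (by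
        simp [firstOrderCoeff]))
      (fun t ht => (hasDerivAt_firstOrderCoeff hP hfp (hεU ht)).congr_deriv (by push_cast; ring))
      (C * (2 * p)! * σ ^ (2 * p))
      (Real.exp (2 * b) * (C * (2 * (p + 1))! * σ ^ (2 * (p + 1)))) (hb p)
      (fun t ht => by
        have h1 := hb (p + 1) t ht
        rw [Function.iterate_succ_apply'] at h1
        have h2 : ‖Complex.exp (2 * t)‖ = Real.exp (2 * t) := by
          rw [Complex.norm_exp]; simp
        rw [norm_mul, h2]
        exact mul_le_mul (Real.exp_le_exp.2 (by linarith [ht.2])) h1 (norm_nonneg _)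
          (Real.exp_pos _).le)
    have hfac : ((2 * p)! : ℝ) ≤ (2 * p + 1 + 2)! := by
      exact_mod_cast Nat.factorial_le (by omega)
    have hfac' : ((2 * (p + 1))! : ℝ) ≤ (2 * p + 1 + 2)! := by
      exact_mod_cast Nat.factorial_le (by omega)
    calc _ ≤ Real.exp v₀ ^ (2 * p) * (K * (C * (2 * p)! * σ ^ (2 * p) +
            Real.exp (2 * b) * (C * (2 * (p + 1))! * σ ^ (2 * (p + 1))))) := by gcongr
      _ ≤ Real.exp v₀ ^ (2 * p) * (K * (C * (2 * p + 1 + 2)! * σ ^ (2 * p) +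
            Real.exp (2 * b) * (C * (2 * p + 1 + 2)! * σ ^ (2 * (p + 1))))) := by gcongr
      _ = C' * (2 * p + 1 + 2)! * (σ * Real.exp v₀) ^ (2 * p + 1) := by
          rw [hC', pow_succ (σ * Real.exp v₀), mul_pow]
          field_simp
          ring
      _ ≤ _ := by gcongr; linarith

end Growth

/-- If every `D^{(n)}` of `g ∘ exp` has factorial growth of type `σ` at `v₀`, the double series
converges absolutely and uniformly on compact sets of radius less than `1/σ - e^{v₀}`. -/
theorem summable_seriesTerm_majorant {d k : ℕ} (hodd : Odd d) (hdk : 2 < d + 2 * k)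
    (g : ℝ → ℂ) (v₀ : ℝ) {C σ : ℝ} (hσ : 0 < σ) (hC0 : 0 ≤ C)
    (hC : ∀ n, ‖genDeriv d k n (fun v => g (Real.exp v)) v₀‖ ≤
      C * (n + 2)! * (σ * Real.exp v₀) ^ n) {K : Set ℂ} (hK : IsCompact K) {R : ℝ} (hR0 : 0 ≤ R)
    (hR : σ * (Real.exp v₀ + R) < 1) (hK0 : ∀ z ∈ K, z ≠ 0 ∧ ‖z‖ ≤ R) :
    ∃ u : (Σ n : ℕ, Fin (n + 1)) → ℝ, Summable u ∧
      ∀ (p : Σ n : ℕ, Fin (n + 1)), ∀ z ∈ K, ‖seriesTerm d k g v₀ p.1 p.2 z‖ ≤ u p := by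
  obtain ⟨c, rfl⟩ := hodd
  obtain ⟨s, hs⟩ : ∃ s, 2 * k + (2 * c + 1) = 2 * s + 3 := ⟨k + c - 1, by omega⟩
  obtain ⟨Q, hQ⟩ := hK.exists_bound_of_continuousOn
    (f := fun z : ℂ => (‖z‖ / Real.exp v₀) ^ (exponent (2 * c + 1) k 0) +
      (‖z‖ / Real.exp v₀) ^ (exponent (2 * c + 1) k 1)) (by
    have h : ContinuousOn (fun z : ℂ => ‖z‖ / Real.exp v₀) K := by fun_prop
    have h0 : ∀ z ∈ K, ‖z‖ / Real.exp v₀ ≠ 0 := fun z hz =>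
      div_ne_zero (norm_ne_zero_iff.2 (hK0 z hz).1) (Real.exp_pos _).ne'
    exact (h.zpow₀ _ fun z hz => .inl (h0 z hz)).add (h.zpow₀ _ fun z hz => .inl (h0 z hz)))
  have hρ := Real.exp_pos v₀
  set θ := σ * (Real.exp v₀ + R) with hθ
  have hθ0 : 0 ≤ θ := by positivity
  -- The majorant does not depend on `j`, so summing over `j ≤ n` costs one more factor `2n + 2`.
  refine ⟨fun p => C * |Q| * ((2 * p.1 + 2 : ℝ) ^ (s + 6) * θ ^ p.1), ?_, ?_⟩
  · have hnn : ∀ n : ℕ, 0 ≤ C * |Q| * ((2 * n + 2 : ℝ) ^ (s + 6) * θ ^ n) :=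
      fun n => by positivity
    refine (summable_sigma_of_nonneg fun p => hnn p.1).2 ⟨fun n => (hasSum_fintype _).summable, ?_⟩
    refine Summable.of_nonneg_of_le (fun n => tsum_nonneg fun _ => hnn n) (fun n => ?_)
      ((summable_pow_mul_geometric (s + 7) hθ0 hR).mul_left (C * |Q|))
    simp only [tsum_fintype]
    rw [Finset.sum_const, Finset.card_univ, Fintype.card_fin, nsmul_eq_mul]
    calc _ ≤ (2 * n + 2 : ℝ) * (C * |Q| * ((2 * n + 2 : ℝ) ^ (s + 6) * θ ^ n)) := by
          refine mul_le_mul_of_nonneg_right ?_ (hnn n)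
          push_cast; linarith [Nat.cast_nonneg (α := ℝ) n]
      _ = _ := by ring
  · rintro ⟨n, j⟩ z hz
    have hq := (le_abs_self _).trans ((hQ z hz).trans (le_abs_self Q))
    refine (norm_seriesTerm_le ⟨c, rfl⟩ hs g v₀ (Nat.lt_succ_iff.1 j.2) (hK0 z hz).1 (hC n)).trans ?_
    calc _ ≤ C * (2 * n + 2) ^ (s + 6) * θ ^ n * |Q| := by
          refine mul_le_mul ?_ hq (by positivity) (by positivity)
          refine mul_le_mul_of_nonneg_left (pow_le_pow_left₀ (by positivity) ?_ n) (by positivity)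
          exact mul_le_mul_of_nonneg_left (by linarith [(hK0 z hz).2]) hσ.le
      _ = _ := by ring

/-- Under factorial growth of type `σ` of the even generalized derivatives between `v₀` and `v`,
the remainders of even order in Taylor's formula tend to zero. -/
theorem tendsto_taylorSum {d k : ℕ} (hodd : Odd d) (hdk : 2 < d + 2 * k)
    (g : ℝ → ℂ) {v₀ v : ℝ}
    (hg : ∀ n, ∀ t ∈ Set.uIcc v₀ v, DifferentiableAt ℝ (genDeriv d k n g) t)
    {C σ : ℝ} (hσ : 0 < σ) (hC0 : 0 ≤ C)
    (hC : ∀ p : ℕ, ∀ t ∈ Set.uIcc v₀ v,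
      ‖genDeriv d k (2 * p) g t‖ ≤ C * (2 * p)! * (σ * Real.exp t) ^ (2 * p))
    (h₀ : 2 * σ * Real.exp v₀ < 1) (h₁ : 2 * σ * Real.exp v < 1) :
    Filter.Tendsto (fun p : ℕ => ∑ n ∈ Finset.range (2 * p + 2),
      genDeriv d k n g v₀ * fundamentalFun d k n (v - v₀)) Filter.atTop (nhds (g v)) := by
  obtain ⟨s, hs⟩ : ∃ s, 2 * k + d = 2 * s + 3 := by
    obtain ⟨c, rfl⟩ := hodd
    exact ⟨k + c - 1, by omega⟩
  set A : ℝ → ℝ := fun u => Real.exp u ^ (exponent d k 0) + Real.exp u ^ (exponent d k 1) with hA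
  have hA0 : ∀ u, 0 ≤ A u := fun u => by positivity
  obtain ⟨Q, hQ⟩ := (isCompact_uIcc (a := v₀) (b := v)).exists_bound_of_continuousOn
    (f := fun t => A (v - t)) (by
      have h : Continuous fun t : ℝ => Real.exp (v - t) := by fun_prop
      exact ((h.zpow₀ _ fun t => .inl (Real.exp_pos _).ne').add
        (h.zpow₀ _ fun t => .inl (Real.exp_pos _).ne')).continuousOn)
  have hQ0 : 0 ≤ Q := (norm_nonneg _).trans (hQ v₀ Set.left_mem_uIcc)
  -- The ratio in the remainder is `σ (e^t + e^v)` with `t` between `v₀` and `v`, and both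
  -- exponentials are at most `e^{max v₀ v}`.
  set θ := 2 * σ * Real.exp (max v₀ v) with hθ
  have hθ0 : 0 ≤ θ := by positivity
  have hθ1 : θ < 1 := by
    rcases max_choice v₀ v with h | h <;> rw [hθ, h] <;> assumption
  have hlim : Filter.Tendsto (fun p : ℕ => C * Q * ((2 * (2 * p + 1 : ℕ) + 2 : ℝ) ^ (s + 6) *
      θ ^ (2 * p + 1)) * ‖v - v₀‖) Filter.atTop (nhds 0) := by
    have h1 := (summable_pow_mul_geometric (s + 6) hθ0 hθ1).tendsto_atTop_zero
    have h2 : Filter.Tendsto (fun p : ℕ => 2 * p + 1) Filter.atTop Filter.atTop :=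
      Filter.tendsto_atTop_mono (fun p => by simp only [id]; omega) Filter.tendsto_id
    simpa using ((h1.comp h2).const_mul (C * Q)).mul_const ‖v - v₀‖
  rw [tendsto_iff_norm_sub_tendsto_zero]
  refine squeeze_zero (fun _ => norm_nonneg _) (fun p => ?_) hlim
  rw [norm_sub_rev]
  refine norm_sub_taylorSum_le hodd k g hg (2 * p + 1) fun t ht => ?_
  set N := 2 * p + 1 with hN
  have hΦ := norm_fundamentalFun_le hodd hs N (v - t)
  have hD := hC (p + 1) t ht
  -- The remainder pairs `(N + 1)!` from `D^{(N+1)}` with `1 / N!` from `Φ_N`. What is left is a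
  -- factor `N + 1` and one spare power of `σ e^t`, which is at most `1`.
  rw [show 2 * (p + 1) = N + 1 by omega] at hD
  have hρ := Real.exp_pos t
  have htm : Real.exp t ≤ Real.exp (max v₀ v) := Real.exp_le_exp.2 ht.2
  have hvm : Real.exp v ≤ Real.exp (max v₀ v) := Real.exp_le_exp.2 (le_max_right _ _)
  have hσt : σ * Real.exp t ≤ 1 := by
    have : σ * Real.exp t ≤ σ * Real.exp (max v₀ v) := by gcongr
    nlinarith
  have hAQ : A (v - t) ≤ Q := (le_abs_self _).trans (hQ t ht)
  have hsum : σ * Real.exp t * (1 + Real.exp (v - t)) = σ * (Real.exp t + Real.exp v) := by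
    rw [Real.exp_sub]; field_simp
  rw [norm_mul]
  calc _ ≤ (C * (N + 1)! * (σ * Real.exp t) ^ (N + 1)) *
        ((2 * N + 2) ^ (s + 5) * (1 + Real.exp (v - t)) ^ N * A (v - t) / N !) :=
        mul_le_mul hD hΦ (norm_nonneg _) (by positivity)
    _ = C * A (v - t) * ((N + 1) * (2 * N + 2) ^ (s + 5) *
        (σ * Real.exp t * (1 + Real.exp (v - t))) ^ N) * (σ * Real.exp t) := by
        rw [Nat.factorial_succ, pow_succ (σ * Real.exp t), mul_pow (σ * Real.exp t)]
        push_cast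
        field_simp
    _ ≤ C * Q * ((2 * N + 2) * (2 * N + 2) ^ (s + 5) * θ ^ N) * 1 := by
        rw [hsum]
        have hb : σ * (Real.exp t + Real.exp v) ≤ θ := by
          rw [hθ]; nlinarith
        have hN1 : (N : ℝ) + 1 ≤ 2 * N + 2 := by linarith [Nat.cast_nonneg (α := ℝ) N]
        gcongr
    _ = _ := by ring

/-- For `τ = 0` the bound `1 / (2τ)` is `∞`, and the conclusion is trivial. -/
theorem mul_lt_one_of_lt_one_div {τ : ℝ≥0} {x : ℝ}
    (h : ENNReal.ofReal x < 1 / (2 * (τ : ℝ≥0∞))) : 2 * (τ : ℝ) * x < 1 := by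
  rcases eq_or_ne τ 0 with rfl | hτ
  · simp
  have hτ0 : 0 < 2 * (τ : ℝ) := by positivity
  have h2 : (1 / (2 * (τ : ℝ≥0∞))) = ENNReal.ofReal (1 / (2 * τ)) := by
    rw [ENNReal.ofReal_div_of_pos hτ0, ENNReal.ofReal_mul (by norm_num)]
    simp
  rw [h2, ENNReal.ofReal_lt_ofReal_iff (by positivity), lt_div_iff₀ hτ0] at h
  linarith

theorem exists_type_gt {τ x : ℝ} (h : τ * x < 1) :
    ∃ σ, τ < σ ∧ σ * x < 1 := by
  have hc : Filter.Tendsto (fun σ : ℝ => σ * x) (nhdsWithin τ (Set.Ioi τ)) (nhds (τ * x)) :=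
    ((continuous_id.mul continuous_const).tendsto τ).mono_left nhdsWithin_le_nhds
  obtain ⟨σ, h1, h2⟩ := ((hc.eventually_lt_const h).and self_mem_nhdsWithin).exists
  exact ⟨σ, h2, h1⟩

end Polyharmonic

/-! ### The main theorem. -/

open Polyharmonic in
theorem mainTheorem6 (d : ℕ) (hd : 1 < d) (hodd : Odd d)
    (r₀ : ℝ≥0) (r₁ : ℝ≥0∞) (hr : (r₀ : ℝ≥0∞) < r₁)
    (τ : ℝ≥0) (hτ : (τ : ℝ≥0∞) < 1 / (2 * (r₀ : ℝ≥0∞)))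
    (f : EuclideanSpace ℝ (Fin d) → ℂ)
    (hf : IsPolyharmonicInfiniteOrder f τ (annularRegion d r₀ r₁))
    (k : ℕ) (Y : Fin (harmonicDim d k) → MvPolynomial (Fin d) ℂ)
    (hY : IsOrthonormalHarmonicBasis d k Y) (l : Fin (harmonicDim d k))
    (v₀ : ℝ) (hv₀ : (r₀ : ℝ) < Real.exp v₀)
    (hv₀' : ENNReal.ofReal (Real.exp v₀) < min r₁ (1 / (2 * (τ : ℝ≥0∞)))) :
    (∀ K : Set ℂ, IsCompact K → K ⊆ {z : ℂ | 0 < ‖z‖ₑ ∧ ‖z‖ₑ < 1 / (2 * (τ : ℝ≥0∞))} →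
      SummableUniformlyOn
        (fun (p : Σ n : ℕ, Fin (n + 1)) (z : ℂ) =>
          ‖seriesTerm d k (fourierLaplaceCoeff f (Y l)) v₀ p.1 p.2 z‖) K ∧
      HasSumUniformlyOn
        (fun (p : Σ n : ℕ, Fin (n + 1)) (z : ℂ) =>
          seriesTerm d k (fourierLaplaceCoeff f (Y l)) v₀ p.1 p.2 z)
        (seriesSum d k (fourierLaplaceCoeff f (Y l)) v₀) K) ∧
    ∀ r : ℝ, (r₀ : ℝ) < r → ENNReal.ofReal r < min r₁ (1 / (2 * (τ : ℝ≥0∞))) →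
      seriesSum d k (fourierLaplaceCoeff f (Y l)) v₀ (r : ℂ) =
        fourierLaplaceCoeff f (Y l) r := by
  have hP : Y l ∈ harmonicHomogeneous d k := by
    rw [← hY.1]; exact Submodule.subset_span ⟨l, rfl⟩
  have hdk : 2 < d + 2 * k := by
    obtain ⟨c, rfl⟩ := hodd; omega
  have hv₀U : v₀ ∈ logRadii r₀ r₁ := ⟨hv₀, hv₀'.trans_le (min_le_left _ _)⟩
  have hρ := Real.exp_pos v₀
  have hρτ := mul_lt_one_of_lt_one_div (hv₀'.trans_le (min_le_right _ _))
  have conv : ∀ K : Set ℂ, IsCompact K →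
      K ⊆ {z : ℂ | 0 < ‖z‖ₑ ∧ ‖z‖ₑ < 1 / (2 * (τ : ℝ≥0∞))} →
      ∃ u : (Σ n : ℕ, Fin (n + 1)) → ℝ, Summable u ∧ ∀ (p : Σ n : ℕ, Fin (n + 1)), ∀ z ∈ K,
        ‖seriesTerm d k (fourierLaplaceCoeff f (Y l)) v₀ p.1 p.2 z‖ ≤ u p := by
    intro K hK hKsub
    -- A compact `K` attains its largest modulus, so the strict inequality `2τR < 1` survives.
    obtain ⟨R, hR0, hRτ, hKR⟩ : ∃ R : ℝ, 0 ≤ R ∧ 2 * (τ : ℝ) * R < 1 ∧ ∀ z ∈ K, ‖z‖ ≤ R := by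
      rcases K.eq_empty_or_nonempty with rfl | hne
      · exact ⟨0, le_rfl, by simp, by simp⟩
      obtain ⟨z, hz, hmax⟩ := hK.exists_isMaxOn hne continuous_norm.continuousOn
      refine ⟨‖z‖, norm_nonneg z, mul_lt_one_of_lt_one_div ?_, fun w hw => hmax hw⟩
      rw [ofReal_norm]
      exact (hKsub hz).2
    -- `τ (e^{v₀} + R)` is the mean of `2τ e^{v₀}` and `2τR`, both below `1`.
    obtain ⟨σ, hσ, hσR⟩ := exists_type_gt (τ := τ) (x := Real.exp v₀ + R)
      (by linarith)
    obtain ⟨C, hC0, hC⟩ := exists_genDeriv_bound hP hf hv₀U hdk hσ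
    exact summable_seriesTerm_majorant hodd hdk _ v₀ (τ.2.trans_lt hσ) hC0 hC hK hR0 hσR
      fun z hz => ⟨enorm_pos.1 (hKsub hz).1, hKR z hz⟩
  have hsum : ∀ {z : ℂ}, Summable (fun p : Σ n : ℕ, Fin (n + 1) =>
      seriesTerm d k (fourierLaplaceCoeff f (Y l)) v₀ p.1 p.2 z) →
      HasSum (fun n : ℕ => ∑ j ∈ Finset.range (n + 1),
        seriesTerm d k (fourierLaplaceCoeff f (Y l)) v₀ n j z)
        (∑' p : Σ n : ℕ, Fin (n + 1),
          seriesTerm d k (fourierLaplaceCoeff f (Y l)) v₀ p.1 p.2 z) := by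
    intro z hz
    refine hz.hasSum.sigma fun n => ?_
    rw [Finset.sum_range]
    exact hasSum_fintype _
  refine ⟨fun K hK hKsub => ?_, fun r hr0 hr1 => ?_⟩
  · obtain ⟨u, hu, hb⟩ := conv K hK hKsub
    refine ⟨(HasSumUniformlyOn.of_norm_le_summable hu fun p z hz => by
      rw [norm_norm]; exact hb p z hz).summableUniformlyOn, ?_⟩
    refine (HasSumUniformlyOn.of_norm_le_summable hu hb).congr_right fun z hz => ?_
    exact (hsum (Summable.of_norm_bounded hu fun p => hb p z hz)).tsum_eq.symm
  · have hrpos : 0 < r := r₀.2.trans_lt hr0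
    obtain ⟨v, rfl⟩ : ∃ v, Real.exp v = r := ⟨Real.log r, Real.exp_log hrpos⟩
    have hvU : v ∈ logRadii r₀ r₁ := ⟨hr0, hr1.trans_le (min_le_left _ _)⟩
    have hvτ := mul_lt_one_of_lt_one_div (hr1.trans_le (min_le_right _ _))
    obtain ⟨u, hu, hb⟩ := conv {(Real.exp v : ℂ)} isCompact_singleton (by
      rintro _ rfl
      refine ⟨enorm_pos.2 (by exact_mod_cast (Real.exp_pos v).ne'), ?_⟩
      rw [← ofReal_norm, Complex.norm_real, Real.norm_of_nonneg hrpos.le]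
      exact hr1.trans_le (min_le_right _ _))
    have hS := hsum (Summable.of_norm_bounded hu fun p => hb p _ rfl)
    obtain ⟨σ, hσ, hσv⟩ := exists_type_gt (τ := τ) (x := 2 * Real.exp (max v₀ v))
      (by rcases max_choice v₀ v with h | h <;> rw [h] <;> linarith)
    have hσ0 : 0 < σ := τ.2.trans_lt hσ
    have hI : Set.uIcc v₀ v ⊆ logRadii r₀ r₁ := (ordConnected_logRadii r₀ r₁).uIcc_subset hv₀U hvU
    obtain ⟨C, hC0, hC⟩ := exists_genDeriv_even_bound hP hf hI hσ
    have hle : ∀ w, w ≤ max v₀ v → 2 * σ * Real.exp w < 1 := fun w hw => by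
      have : σ * Real.exp w ≤ σ * Real.exp (max v₀ v) := by gcongr
      linarith
    have hT := tendsto_taylorSum hodd hdk _
      (fun n t ht => differentiableAt_genDeriv hP hf.1 n (hI ht)) hσ0 hC0 hC
      (hle _ (le_max_left _ _)) (hle _ (le_max_right _ _))
    -- Convergence of the series is already known, so its sum may be identified along the partial
    -- sums with `2p + 2` terms.
    have hS' := hS.tendsto_sum_nat.comp (Filter.tendsto_atTop_mono (f := id)
      (g := fun p : ℕ => 2 * p + 2) (fun p => by simp only [id]; omega) Filter.tendsto_id)
    simp only [seriesTerm_exp, Function.comp_def] at hS'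
    rw [seriesSum, hS.tsum_eq]
    exact tendsto_nhds_unique hS' hT
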